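/- For every even integer $N\ge 2$ let $\mathcal H_N=\mathbb C^N$ with its standard Hermitian inner product (antilinear in the first argument) and the position basis $\mathbf q_0,\dots,\mathbf q_{N-1}$. Let $(\hat F_N)_{kj}=N^{-1/2}e^{-2\pi i kj/N}$, $0\le k,j<N$, be the discrete Fourier transform, and let $$\hat B_N=\hat F_N^{-1}\begin{pmatrix}\hat F_{N/2}&0\\0&\hat F_{N/2}\end{pmatrix}$$ be the quantised baker's map. For $\mathbf k=(k_1,k_2)\in\mathbb Z^2$ let $T(\mathbf k)$ be the quantum translation on $\mathcal H_N$, $(T(\mathbf k)\psi)_n=e^{-\pi i k_1k_2/N}e^{2\pi i k_2 n/N}\psi_{n-k_1}$ (indices modulo $N$), and for $a\in C^\infty(\mathbb T^2)$, $\mathbb T^2=\mathbb R^2/\mathbb Z^2$, with Fourier expansion $a(q,p)=\sum_{\mathbf k\in\mathbb Z^2}\tilde a(\mathbf k)\,e^{2\pi i(qk_2-pk_1)}$, let $\mathrm{Op}^{\rm W}_N(a)=\sum_{\mathbf k\in\mathbb Z^2}\tilde a(\mathbf k)\,T(\mathbf k)$ be its Weyl quantisation. For every even $N\ge2$ let $\varphi_{N,1},\dots,\varphi_{N,N}$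 be an arbitrary orthonormal basis of $\mathcal H_N$ consisting of eigenvectors of $\hat B_N$. Then for each even $N\ge 2$ there exists a non-empty subset $J_N\subset\{1,\dots,N\}$, with $\#J_N/N\to1$ as $N\to\infty$, such that for every $a\in C^\infty(\mathbb T^2)$ and every sequence $(j_N)_{N\in 2\mathbb N}$ with $j_N\in J_N$, $$\lim_{N\to\infty}\big\langle\varphi_{N,j_N},\mathrm{Op}^{\rm W}_N(a)\,\varphi_{N,j_N}\big\rangle=\int_{\mathbb T^2}a(\mathbf x)\,d\mathbf x .$$ The sets $J_N$ do not depend on $a$ or on the sequence. -/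

import Mathlib

open Filter Topology MeasureTheory
open scoped ContDiff

noncomputable section

namespace QuantumBaker

/-- The admissible inverse Planck constants `N ∈ {2, 4, 6, …}`. -/
abbrev EvenPos : Type := {N : ℕ // 0 < N ∧ Even N}

/-- `a ∈ C^∞(𝕋²)`: a smooth complex function of `x = (q, p) ∈ ℝ²` which is `ℤ²`-periodic. -/
structure IsSmoothOnTorus (a : ℝ × ℝ → ℂ) : Prop where
  contDiff : ContDiff ℝ ∞ a
  periodic : ∀ (q p : ℝ) (m n : ℤ), a (q + m, p + n) = a (q, p)

/-- The integral over the torus, identified with the square `[0,1) × [0,1)`. -/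
def torusIntegral (a : ℝ × ℝ → ℂ) : ℂ :=
  ∫ x in Set.Ico (0 : ℝ) 1 ×ˢ Set.Ico (0 : ℝ) 1, a x

/-- The Fourier mode `e_k(q, p) = exp (2πi (q k₂ - p k₁))`. -/
def fourierMode (k : ℤ × ℤ) (x : ℝ × ℝ) : ℂ :=
  Complex.exp (2 * Real.pi * Complex.I * (x.1 * k.2 - x.2 * k.1))

/-- The coefficient of `e_k` in the Fourier expansion of `a`. -/
def torusFourierCoeff (a : ℝ × ℝ → ℂ) (k : ℤ × ℤ) : ℂ :=
  torusIntegral fun x => (starRingEnd ℂ) (fourierMode k x) * a x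

/-- The `N`-dimensional quantum space, in the orthonormal position basis `𝐪₀, …, 𝐪_{N-1}`.
The vector `ψ` is the distribution
`N ^ (-1/2) * ∑_{j < N} ∑_{ν ∈ ℤ} ψ_j δ(q - j/N + ν)` on the line. -/
abbrev QState (N : ℕ) : Type := EuclideanSpace ℂ (Fin N)

/-- The quantum translation `T(k) = T̂_{k/N}` on the quantum space, in the position basis, where
`T̂_v = exp (i (v₂ q̂ - v₁ p̂) / ħ)`, that is,
`(T̂_v ψ)(q) = exp (-i v₁ v₂ / (2ħ)) * exp (i v₂ q / ħ) * ψ (q - v₁)`, with `ħ = 1 / (2πN)`.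
For `v = k/N` and at the point `q = i/N` this reads
`(T(k) ψ)_i = exp (-πi k₁ k₂ / N) * exp (2πi k₂ i / N) * ψ_{i - k₁}` (index modulo `N`). -/
def weylTranslation (N : ℕ) (k : ℤ × ℤ) : Matrix (Fin N) (Fin N) ℂ :=
  Matrix.of fun i j =>
    if ((i : ℕ) : ℤ) ≡ ((j : ℕ) : ℤ) + k.1 [ZMOD (N : ℤ)] then
      Complex.exp (-(Real.pi * Complex.I * (k.1 * k.2) / N)) *
        Complex.exp (2 * Real.pi * Complex.I * (k.2 * ((i : ℕ) : ℂ)) / N)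
    else 0

/-- The Weyl quantisation `Op^W_N(a) = ∑_{k ∈ ℤ²} ã(k) T(k)`. -/
def weylOp (N : ℕ) (a : ℝ × ℝ → ℂ) : Matrix (Fin N) (Fin N) ℂ :=
  ∑' k : ℤ × ℤ, torusFourierCoeff a k • weylTranslation N k

/-- The discrete Fourier transform, `(F_N)_{kj} = N ^ (-1/2) * exp (-2πi k j / N)`. -/
def dft (N : ℕ) : Matrix (Fin N) (Fin N) ℂ :=
  Matrix.of fun k j =>
    1 / (Real.sqrt N : ℂ) *
      Complex.exp (-(2 * Real.pi * Complex.I * (((k : ℕ) : ℂ) * ((j : ℕ) : ℂ)) / N))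

/-- The splitting of `{0, …, N-1}` into its lower and its upper half, for even `N`. -/
def halves (N : EvenPos) : Fin (N.1 / 2) ⊕ Fin (N.1 / 2) ≃ Fin N.1 :=
  finSumFinEquiv.trans (finCongr (by have := Nat.div_two_mul_two_of_even N.2.2; omega))

/-- The block matrix `diag (F_{N/2}, F_{N/2})`. -/
def bakerMix (N : EvenPos) : Matrix (Fin N.1) (Fin N.1) ℂ :=
  (Matrix.fromBlocks (dft (N.1 / 2)) 0 0 (dft (N.1 / 2))).reindex (halves N) (halves N)

/-- The quantised baker's map of Balazs and Voros, `B_N = F_N⁻¹ diag (F_{N/2}, F_{N/2})`. -/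
def bakerOp (N : EvenPos) : Matrix (Fin N.1) (Fin N.1) ℂ :=
  (dft N.1)⁻¹ * bakerMix N

/-- The diagonal matrix element `⟨ψ, Aψ⟩` of an operator given by its matrix in the position
basis. The inner product is antilinear in its first argument. -/
def expectation {N : ℕ} (A : Matrix (Fin N) (Fin N) ℂ) (ψ : QState N) : ℂ :=
  inner ℂ ψ (Matrix.toEuclideanLin A ψ)

end QuantumBaker

end

/-!
Write `U` for the evolution `A ↦ B_N⁻¹ A B_N`, and call a sequence of operators ergodic if its
diagonal matrix elements in the eigenbases differ from the normalised trace by an amount which tends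
to zero in mean over the basis. This is stable under errors which are small in the normalised
Hilbert–Schmidt norm, and `U A - A` is always ergodic.

The baker's map stretches the position and contracts the momentum by the factor 2. On the quantum
side, up to small errors, `U` doubles the frequency of `e^{2πimq}`, and it turns `e^{2πiκp}` into
`e^{2πiκp/2}` times a unitary function of the position. Hence `e^{2πimq}` is, modulo ergodic
sequences, the average of `e^{2πi 2^t m q}` over `t < n`, whose norm is `n^{-1/2}`; so functions of
the position are ergodic. Evolving `f(q) e^{2πiκp}` for a long time makes the frequency in the
momentum arbitrarily small and reduces the Weyl translations to functions of the position.

Markov's inequality, applied to a weighted sum over all frequencies, yields one set of indices of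
density one that works for all Weyl translations, and the absolutely convergent Fourier expansion
extends the limit to all smooth observables.
-/

noncomputable section

namespace QuantumBaker

open scoped FourierTransform

/-! ### Asymptotic closures -/

section AsympClosure

variable {ι : Type*} {l : Filter ι} {E F : ι → Type*}
  [∀ i, AddCommGroup (E i)] [∀ i, Module ℂ (E i)] [∀ i, AddCommGroup (F i)] [∀ i, Module ℂ (F i)]
  {p : ∀ i, Seminorm ℂ (E i)} {q : ∀ i, Seminorm ℂ (F i)} {S : Submodule ℂ (∀ i, E i)}
  {A B : ∀ i, E i}

/-- The families which are, for every `ε > 0`, eventually `ε`-close to a family in `S`, closeness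
being measured by the seminorms `p`. -/
def asympClosure (l : Filter ι) (p : ∀ i, Seminorm ℂ (E i)) (S : Submodule ℂ (∀ i, E i)) :
    Submodule ℂ (∀ i, E i) where
  carrier := {A | ∀ ε > 0, ∃ B ∈ S, ∀ᶠ i in l, p i (A i - B i) ≤ ε}
  zero_mem' ε hε := ⟨0, S.zero_mem, Eventually.of_forall fun i => by simpa using hε.le⟩
  add_mem' := by
    intro A A' hA hA' ε hε
    obtain ⟨B, hB, hAB⟩ := hA (ε / 2) (half_pos hε)
    obtain ⟨B', hB', hAB'⟩ := hA' (ε / 2) (half_pos hε)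
    refine ⟨B + B', S.add_mem hB hB', ?_⟩
    filter_upwards [hAB, hAB'] with i h h'
    calc p i (A i + A' i - (B i + B' i)) = p i ((A i - B i) + (A' i - B' i)) := by abel_nf
      _ ≤ p i (A i - B i) + p i (A' i - B' i) := map_add_le_add _ _ _
      _ ≤ ε := by linarith
  smul_mem' := by
    intro c A hA ε hε
    obtain ⟨B, hB, hAB⟩ := hA (ε / (‖c‖ + 1)) (by positivity)
    refine ⟨c • B, S.smul_mem c hB, ?_⟩
    filter_upwards [hAB] with i h
    calc p i (c • A i - c • B i) = ‖c‖ * p i (A i - B i) := by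
          rw [← smul_sub, map_smul_eq_mul]
      _ ≤ (‖c‖ + 1) * (ε / (‖c‖ + 1)) := by gcongr; linarith
      _ = ε := mul_div_cancel₀ ε (by positivity)

/-- The families which are negligible for the seminorms `p`. -/
def nullFamilies (l : Filter ι) (p : ∀ i, Seminorm ℂ (E i)) : Submodule ℂ (∀ i, E i) :=
  asympClosure l p ⊥

lemma mem_asympClosure :
    A ∈ asympClosure l p S ↔ ∀ ε > 0, ∃ B ∈ S, ∀ᶠ i in l, p i (A i - B i) ≤ ε := Iff.rfl

lemma mem_nullFamilies : A ∈ nullFamilies l p ↔ Tendsto (fun i => p i (A i)) l (𝓝 0) := by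
  simp only [nullFamilies, mem_asympClosure, Submodule.mem_bot, exists_eq_left, Pi.zero_apply,
    sub_zero]
  constructor
  · intro h
    refine tendsto_order.2 ⟨fun a ha => Eventually.of_forall fun i => ha.trans_le
      (apply_nonneg _ _), fun a ha => ?_⟩
    filter_upwards [h (a / 2) (half_pos ha)] with i hi
    linarith
  · exact fun h ε hε => h.eventually_le_const hε

lemma mem_nullFamilies_of_le {u : ι → ℝ} (hu : Tendsto u l (𝓝 0)) (h : ∀ i, p i (A i) ≤ u i) :
    A ∈ nullFamilies l p :=
  mem_nullFamilies.2 (squeeze_zero (fun _ => apply_nonneg _ _) h hu)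

lemma le_asympClosure : S ≤ asympClosure l p S := fun A hA _ hε =>
  ⟨A, hA, Eventually.of_forall fun _ => by simpa using hε.le⟩

lemma asympClosure_mono {T : Submodule ℂ (∀ i, E i)} (h : S ≤ T) :
    asympClosure l p S ≤ asympClosure l p T := fun _ hA ε hε =>
  let ⟨B, hB, hAB⟩ := hA ε hε
  ⟨B, h hB, hAB⟩

lemma nullFamilies_le_asympClosure : nullFamilies l p ≤ asympClosure l p S :=
  asympClosure_mono bot_le

lemma map_mem_asympClosure {T : Submodule ℂ (∀ i, F i)} (L : (∀ i, E i) →ₗ[ℂ] ∀ i, F i) {C : ℝ}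
    (hL : ∀ A i, q i (L A i) ≤ C * p i (A i)) (hST : S ≤ (asympClosure l q T).comap L)
    (hA : A ∈ asympClosure l p S) : L A ∈ asympClosure l q T := by
  intro ε hε
  obtain ⟨B, hB, hAB⟩ := hA (ε / (2 * (|C| + 1))) (by positivity)
  obtain ⟨D, hD, hBD⟩ := hST hB (ε / 2) (half_pos hε)
  refine ⟨D, hD, ?_⟩
  filter_upwards [hAB, hBD] with i h h'
  calc q i (L A i - D i) = q i (L (A - B) i + (L B i - D i)) := by
        rw [map_sub L, Pi.sub_apply (L A), sub_add_sub_cancel]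
    _ ≤ q i (L (A - B) i) + q i (L B i - D i) := map_add_le_add _ _ _
    _ ≤ (|C| + 1) * (ε / (2 * (|C| + 1))) + ε / 2 := by
        refine add_le_add ((hL _ i).trans ?_) h'
        gcongr
        · linarith [le_abs_self C]
        · exact h
    _ = ε := by field_simp; ring

lemma asympClosure_idem : asympClosure l p (asympClosure l p S) = asympClosure l p S :=
  le_antisymm (fun _ hA => map_mem_asympClosure LinearMap.id (C := 1) (by simp) le_rfl hA)
    le_asympClosure

lemma mem_asympClosure_of_sub_mem (hB : B ∈ asympClosure l p S) (h : A - B ∈ nullFamilies l p) :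
    A ∈ asympClosure l p S := by
  simpa using add_mem (nullFamilies_le_asympClosure h) hB

end AsympClosure

/-! ### The normalised Hilbert–Schmidt norm -/

section HilbertSchmidt

open scoped Matrix.Norms.Frobenius

variable {n : Type*} [Fintype n]

/-- The Hilbert–Schmidt norm of an `n × n` matrix, normalised so that unitary matrices have
norm `1`. -/
def hsNorm : Seminorm ℂ (Matrix n n ℂ) :=
  (NNReal.sqrt (Fintype.card n))⁻¹ • normSeminorm ℂ (Matrix n n ℂ)

lemma hsNorm_eq_norm_div (A : Matrix n n ℂ) : hsNorm A = ‖A‖ / √(Fintype.card n) := by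
  rw [hsNorm, smul_apply, coe_normSeminorm, NNReal.smul_def, smul_eq_mul, div_eq_inv_mul]
  simp

lemma hsNorm_eq_sqrt_sum (A : Matrix n n ℂ) :
    hsNorm A = √((∑ i, ∑ j, ‖A i j‖ ^ 2) / Fintype.card n) := by
  rw [hsNorm_eq_norm_div, Matrix.frobenius_norm_def, Real.sqrt_div (by positivity),
    Real.sqrt_eq_rpow, Real.sqrt_eq_rpow]
  simp

lemma hsNorm_sq_eq_trace (A : Matrix n n ℂ) :
    ((hsNorm A ^ 2 : ℝ) : ℂ) = (star A * A).trace / Fintype.card n := by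
  rw [hsNorm_eq_sqrt_sum, Real.sq_sqrt (by positivity), Finset.sum_comm]
  simp [Matrix.trace, Matrix.mul_apply, Complex.conj_mul']

lemma hsNorm_star (A : Matrix n n ℂ) : hsNorm (star A) = hsNorm A := by
  rw [hsNorm_eq_norm_div, hsNorm_eq_norm_div, Matrix.star_eq_conjTranspose,
    Matrix.frobenius_norm_conjTranspose]

variable [DecidableEq n] {U V : Matrix n n ℂ}

lemma hsNorm_unitary_mul (hU : U ∈ Matrix.unitaryGroup n ℂ) (A : Matrix n n ℂ) :
    hsNorm (U * A) = hsNorm A := by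
  refine (sq_eq_sq₀ (apply_nonneg _ _) (apply_nonneg _ _)).1 (Complex.ofReal_injective ?_)
  rw [hsNorm_sq_eq_trace, hsNorm_sq_eq_trace, star_mul, mul_assoc, ← mul_assoc (star U),
    Unitary.star_mul_self_of_mem hU, one_mul]

lemma hsNorm_mul_unitary (hU : U ∈ Matrix.unitaryGroup n ℂ) (A : Matrix n n ℂ) :
    hsNorm (A * U) = hsNorm A := by
  rw [← hsNorm_star, star_mul, hsNorm_unitary_mul (Unitary.star_mem hU), hsNorm_star]

lemma hsNorm_diagonal_le {d : n → ℂ} {C : ℝ} (hC : 0 ≤ C) (h : ∀ i, ‖d i‖ ≤ C) :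
    hsNorm (Matrix.diagonal d) ≤ C := by
  rw [hsNorm_eq_norm_div, Matrix.frobenius_norm_diagonal, EuclideanSpace.norm_eq,
    ← Real.sqrt_div (by positivity)]
  refine Real.sqrt_le_iff.2 ⟨hC, div_le_of_le_mul₀ (by positivity) (by positivity) ?_⟩
  calc ∑ i, ‖d i‖ ^ 2 ≤ ∑ _i : n, C ^ 2 := by gcongr with i; exact h i
    _ = C ^ 2 * Fintype.card n := by simp [mul_comm]

lemma sum_norm_sq_col_of_mem_unitaryGroup (hU : U ∈ Matrix.unitaryGroup n ℂ) (j : n) :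
    ∑ i, ‖U i j‖ ^ 2 = 1 := by
  have h := congr_fun₂ (Matrix.mem_unitaryGroup_iff'.1 hU) j j
  rw [Matrix.mul_apply, Matrix.one_apply_eq] at h
  rw [← Complex.ofReal_inj, Complex.ofReal_one, ← h]
  simp [Complex.conj_mul']

/-- Each of the columns on which `U` and `V` differ contributes at most `2 ^ 2`. -/
lemma hsNorm_sub_le_of_col_eq (hU : U ∈ Matrix.unitaryGroup n ℂ)
    (hV : V ∈ Matrix.unitaryGroup n ℂ) (S : Finset n) (h : ∀ j ∉ S, ∀ i, U i j = V i j) :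
    hsNorm (U - V) ≤ √(4 * S.card / Fintype.card n) := by
  rw [hsNorm_eq_sqrt_sum]
  gcongr
  have hcol : ∀ j, ∑ i, ‖(U - V) i j‖ ^ 2 ≤ 4 := fun j => calc
    ∑ i, ‖(U - V) i j‖ ^ 2 ≤ ∑ i, 2 * (‖U i j‖ ^ 2 + ‖V i j‖ ^ 2) := by
      gcongr with i
      rw [Matrix.sub_apply]
      exact (pow_le_pow_left₀ (norm_nonneg _) (norm_sub_le _ _) 2).trans add_sq_le
    _ = 4 := by
      rw [← Finset.mul_sum, Finset.sum_add_distrib, sum_norm_sq_col_of_mem_unitaryGroup hU,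
        sum_norm_sq_col_of_mem_unitaryGroup hV]
      norm_num
  calc ∑ i, ∑ j, ‖(U - V) i j‖ ^ 2 = ∑ j, ∑ i, ‖(U - V) i j‖ ^ 2 := Finset.sum_comm
    _ = ∑ j ∈ S, ∑ i, ‖(U - V) i j‖ ^ 2 := by
      refine (Finset.sum_subset S.subset_univ fun j _ hj => ?_).symm
      simp [h j hj]
    _ ≤ ∑ _j ∈ S, 4 := Finset.sum_le_sum fun j _ => hcol j
    _ = 4 * S.card := by simp [mul_comm]

end HilbertSchmidt

/-! ### The discrete Fourier transform and the clock matrices -/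

lemma fourierChar_eq_one_iff {x : ℝ} : 𝐞 x = 1 ↔ ∃ m : ℤ, x = m := by
  rw [Real.fourierChar_apply', Circle.exp_eq_one]
  exact exists_congr fun m => by rw [mul_comm, mul_left_inj' Real.two_pi_pos.ne']

@[simp] lemma fourierChar_intCast (m : ℤ) : 𝐞 (m : ℝ) = 1 := fourierChar_eq_one_iff.2 ⟨m, rfl⟩

lemma fourierChar_eq_of_sub_eq_intCast {x y : ℝ} (m : ℤ) (h : x - y = m) : 𝐞 x = 𝐞 y := by
  rw [← div_eq_one, ← AddChar.map_sub_eq_div, h, fourierChar_intCast]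

lemma star_fourierChar (x : ℝ) : star (𝐞 x : ℂ) = 𝐞 (-x) := by
  rw [AddChar.map_neg_eq_inv, Circle.coe_inv_eq_conj, starRingEnd_apply]

lemma coe_fourierChar_add (x y : ℝ) : (𝐞 (x + y) : ℂ) = 𝐞 x * 𝐞 y := by
  rw [AddChar.map_add_eq_mul, Circle.coe_mul]

lemma norm_fourierChar_sub_one_le (x : ℝ) : ‖(𝐞 x : ℂ) - 1‖ ≤ 2 * Real.pi * |x| := by
  rw [Real.fourierChar_apply, mul_comm _ Complex.I]
  refine (Real.norm_exp_I_mul_ofReal_sub_one_le (x := 2 * Real.pi * x)).trans_eq ?_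
  rw [Real.norm_eq_abs, abs_mul, abs_of_pos Real.two_pi_pos]

lemma sum_fourierChar_div (M : ℕ) (m : ℤ) :
    ∑ n : Fin M, (𝐞 (m * n / M) : ℂ) = if (M : ℤ) ∣ m then (M : ℂ) else 0 := by
  rcases M.eq_zero_or_pos with rfl | hM
  · simp
  have hM' : (M : ℝ) ≠ 0 := by positivity
  have hpow (n : ℕ) : 𝐞 (m * n / M) = 𝐞 (m / M) ^ n := by
    rw [← AddChar.map_nsmul_eq_pow, nsmul_eq_mul]
    congr 1
    ring
  split_ifs with hm
  · obtain ⟨c, rfl⟩ := hm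
    have hone : 𝐞 (((M * c : ℤ) : ℝ) / M) = 1 :=
      fourierChar_eq_one_iff.2 ⟨c, by push_cast; field_simp⟩
    simp only [hpow, hone, one_pow]
    simp
  · have hne : (𝐞 (m / M) : ℂ) ≠ 1 := by
      rw [Ne, Circle.coe_eq_one, fourierChar_eq_one_iff]
      rintro ⟨c, hc⟩
      rw [div_eq_iff hM', mul_comm] at hc
      exact hm ⟨c, by exact_mod_cast hc⟩
    have hM_pow : 𝐞 (m / M) ^ M = 1 := by rw [← hpow, mul_div_cancel_right₀ _ hM']; simp
    simp only [hpow, Circle.coe_pow]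
    rw [Fin.sum_univ_eq_sum_range (fun n => (𝐞 (m / M) : ℂ) ^ n) M, geom_sum_eq hne,
      ← Circle.coe_pow, hM_pow]
    simp

lemma dft_apply (M : ℕ) (k j : Fin M) : dft M k j = (√M : ℂ)⁻¹ * 𝐞 (-(k * j) / M) := by
  rw [dft, Matrix.of_apply, Real.fourierChar_apply, one_div]
  congr 2
  push_cast
  ring

lemma transpose_dft (M : ℕ) : (dft M).transpose = dft M := by
  ext k j
  rw [Matrix.transpose_apply, dft_apply, dft_apply, mul_comm (j : ℝ)]

/-- The function `e^{2πiκq}` of the position, sampled at `q = n / M`. The frequency `κ` is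
real: it need not be an integer. -/
def clock (M : ℕ) (κ : ℝ) : Matrix (Fin M) (Fin M) ℂ :=
  Matrix.diagonal fun n => (𝐞 (κ * n / M) : ℂ)

/-- The function `e^{2πiκp}` of the momentum, the momentum eigenvectors being the conjugated rows
of `dft M`. The frequency `κ` is real: it need not be an integer. -/
def momClock (M : ℕ) (κ : ℝ) : Matrix (Fin M) (Fin M) ℂ :=
  star (dft M) * clock M κ * dft M

@[simp] lemma clock_zero (M : ℕ) : clock M 0 = 1 := by
  simp [clock]

lemma clock_add (M : ℕ) (κ μ : ℝ) : clock M (κ + μ) = clock M κ * clock M μ := by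
  simp only [clock, Matrix.diagonal_mul_diagonal, add_mul, add_div, coe_fourierChar_add]

lemma star_clock (M : ℕ) (κ : ℝ) : star (clock M κ) = clock M (-κ) := by
  rw [clock, clock, Matrix.star_eq_conjTranspose, Matrix.diagonal_conjTranspose]
  congr 1
  funext n
  rw [Pi.star_apply, star_fourierChar, neg_mul, neg_div]

lemma diagonal_mem_unitaryGroup {n : Type*} [Fintype n] [DecidableEq n] (c : n → Circle) :
    Matrix.diagonal (fun i => (c i : ℂ)) ∈ Matrix.unitaryGroup n ℂ := by
  rw [Matrix.mem_unitaryGroup_iff, Matrix.star_eq_conjTranspose, Matrix.diagonal_conjTranspose,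
    Matrix.diagonal_mul_diagonal, ← Matrix.diagonal_one]
  congr 1
  funext i
  rw [Pi.star_apply, ← starRingEnd_apply, Complex.mul_conj', Circle.norm_coe]
  simp

lemma clock_mem_unitaryGroup (M : ℕ) (κ : ℝ) : clock M κ ∈ Matrix.unitaryGroup (Fin M) ℂ :=
  diagonal_mem_unitaryGroup _

lemma trace_clock (M : ℕ) (m : ℤ) : (clock M m).trace = if (M : ℤ) ∣ m then (M : ℂ) else 0 := by
  rw [clock, Matrix.trace_diagonal, sum_fourierChar_div]

lemma momClock_intCast_apply (M : ℕ) (m : ℤ) (i j : Fin M) :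
    momClock M m i j = if (M : ℤ) ∣ i + m - j then 1 else 0 := by
  have hM : (M : ℂ) ≠ 0 := by exact_mod_cast i.pos.ne'
  have hsqrt : (√M : ℂ) * √M = M := by
    rw [← Complex.ofReal_mul, Real.mul_self_sqrt M.cast_nonneg, Complex.ofReal_natCast]
  have hterm (l : Fin M) : (star (dft M) * clock M m) i l * dft M l j =
      (M : ℂ)⁻¹ * 𝐞 (((i + m - j : ℤ) : ℝ) * l / M) := by
    rw [clock, Matrix.mul_diagonal, Matrix.star_apply, dft_apply, dft_apply, star_mul',
      star_fourierChar, ← hsqrt, mul_inv, star_inv₀, ← starRingEnd_apply, Complex.conj_ofReal]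
    have hexp : ((i + m - j : ℤ) : ℝ) * l / M =
        -(-(l * i) / M) + m * l / M + -(l * j) / M := by push_cast; ring
    rw [hexp, coe_fourierChar_add, coe_fourierChar_add]
    ring
  rw [momClock, Matrix.mul_apply, Finset.sum_congr rfl fun l _ => hterm l, ← Finset.mul_sum,
    sum_fourierChar_div, mul_ite, inv_mul_cancel₀ hM, mul_zero]

lemma momClock_zero (M : ℕ) : momClock M 0 = 1 := by
  ext i j
  rw [← Int.cast_zero, momClock_intCast_apply, Matrix.one_apply, add_zero]
  congr 1
  refine propext ⟨fun h => ?_, fun h => by simp [h]⟩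
  have := Int.eq_zero_of_abs_lt_dvd h (by rw [abs_lt]; omega)
  omega

lemma dft_mem_unitaryGroup (M : ℕ) : dft M ∈ Matrix.unitaryGroup (Fin M) ℂ := by
  rw [Matrix.mem_unitaryGroup_iff', ← momClock_zero, momClock, clock_zero, mul_one]

lemma momClock_mem_unitaryGroup (M : ℕ) (κ : ℝ) :
    momClock M κ ∈ Matrix.unitaryGroup (Fin M) ℂ :=
  mul_mem (mul_mem (Unitary.star_mem (dft_mem_unitaryGroup M)) (clock_mem_unitaryGroup M κ))
    (dft_mem_unitaryGroup M)

lemma dft_mul_clock_mul_star_dft (M : ℕ) (m : ℤ) :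
    dft M * clock M m * star (dft M) = momClock M (-m) := by
  have hstar : (star (dft M)).transpose = star (dft M) := by
    rw [Matrix.star_eq_conjTranspose, Matrix.conjTranspose, transpose_dft, ← Matrix.transpose_map,
      transpose_dft]
  have h : dft M * clock M m * star (dft M) = (momClock M m).transpose := by
    rw [momClock, Matrix.transpose_mul, Matrix.transpose_mul, hstar, transpose_dft, clock,
      Matrix.diagonal_transpose, mul_assoc]
  ext i j
  rw [h, Matrix.transpose_apply, ← Int.cast_neg, momClock_intCast_apply, momClock_intCast_apply,
    show (i + -m - j : ℤ) = -(j + m - i) by ring]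
  simp only [dvd_neg]

lemma hsNorm_momClock_sub_one_le (M : ℕ) (κ : ℝ) :
    hsNorm (momClock M κ - 1) ≤ 2 * Real.pi * |κ| := by
  have h : momClock M κ - 1 = star (dft M) * (clock M κ - 1) * dft M := by
    rw [mul_sub, sub_mul, mul_one, Unitary.star_mul_self_of_mem (dft_mem_unitaryGroup M), momClock]
  rw [h, hsNorm_mul_unitary (dft_mem_unitaryGroup M),
    hsNorm_unitary_mul (Unitary.star_mem (dft_mem_unitaryGroup M)), clock, ← Matrix.diagonal_one,
    Matrix.diagonal_sub]
  refine hsNorm_diagonal_le (by positivity) fun n => (norm_fourierChar_sub_one_le _).trans ?_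
  have hn : (n : ℝ) / M ≤ 1 := div_le_one_of_le₀ (by exact_mod_cast n.2.le) M.cast_nonneg
  rw [mul_div_assoc, abs_mul, abs_of_nonneg (by positivity : (0 : ℝ) ≤ n / M)]
  gcongr
  exact mul_le_of_le_one_right (abs_nonneg κ) hn

/-! ### Approximation of clock matrices by integer frequencies -/

lemma card_filter_le_val_add (M b : ℕ) :
    (Finset.univ.filter fun j : Fin M => M ≤ j + b).card ≤ b := by
  rw [← Finset.card_range b]
  refine Finset.card_le_card_of_injOn (fun j => j.rev) (fun j hj => ?_)
    (Fin.val_injective.comp Fin.rev_injective).injOn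
  have hj' : M ≤ j + b := by simpa using hj
  simp only [Fin.val_rev, Finset.coe_range, Set.mem_Iio]
  omega

lemma exists_sum_fourierChar_near {c : ℝ → ℂ} (hc : Continuous c) (h01 : c 0 = c 1) {ε : ℝ}
    (hε : 0 < ε) :
    ∃ (s : Finset ℤ) (g : ℤ → ℂ), ∀ x ∈ Set.Ico (0 : ℝ) 1,
      ‖c x - ∑ m ∈ s, g m * 𝐞 (m * x)‖ ≤ ε := by
  have : Fact ((0 : ℝ) < 1) := ⟨one_pos⟩
  let F : C(AddCircle (1 : ℝ), ℂ) :=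
    ⟨AddCircle.liftIco 1 0 c, AddCircle.liftIco_zero_continuous h01 hc.continuousOn⟩
  have hF : F ∈ (Submodule.span ℂ (Set.range <| @fourier 1)).topologicalClosure := by
    rw [span_fourier_closure_eq_top]; trivial
  rw [← SetLike.mem_coe, Submodule.topologicalClosure_coe, Metric.mem_closure_iff] at hF
  obtain ⟨P, hP, hFP⟩ := hF ε hε
  rw [SetLike.mem_coe, Finsupp.mem_span_range_iff_exists_finsupp] at hP
  obtain ⟨g, rfl⟩ := hP
  refine ⟨g.support, g, fun x hx => ?_⟩
  have hFx : F (x : AddCircle (1 : ℝ)) = c x := AddCircle.liftIco_zero_coe_apply hx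
  have hPx : (g.sum fun m a => a • @fourier 1 m) (x : AddCircle (1 : ℝ)) =
      ∑ m ∈ g.support, g m * 𝐞 (m * x) := by
    rw [Finsupp.sum, ContinuousMap.sum_apply]
    refine Finset.sum_congr rfl fun m _ => ?_
    rw [ContinuousMap.smul_apply, fourier_coe_apply, smul_eq_mul, Real.fourierChar_apply]
    congr 2
    push_cast
    ring
  rw [← hFx, ← hPx, ← ContinuousMap.sub_apply]
  exact (ContinuousMap.norm_coe_le_norm _ _).trans (by rw [← dist_eq_norm]; exact hFP.le)

/-- A continuous unimodular function which takes the same value at `0` and at `1`, and agrees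
with `x ↦ 𝐞 (κ x)` except near `1`. -/
def cutoffChar (κ : ℝ) (K : ℕ) (x : ℝ) : Circle := 𝐞 (κ * min x (K * (1 - x)))

lemma continuous_cutoffChar (κ : ℝ) (K : ℕ) : Continuous (cutoffChar κ K) :=
  Real.continuous_fourierChar.comp (by fun_prop)

lemma cutoffChar_zero_eq_one (κ : ℝ) (K : ℕ) : cutoffChar κ K 0 = cutoffChar κ K 1 := by
  simp [cutoffChar]

lemma cutoffChar_div_of_lt (κ : ℝ) {K M n : ℕ} (hK : 0 < K) (hn : n + M / K < M) :
    cutoffChar κ K (n / M) = 𝐞 (κ * n / M) := by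
  have hM : (0 : ℝ) < M := by exact_mod_cast (Nat.zero_le _).trans_lt hn
  have hnM : n ≤ M := (Nat.le_add_right _ _).trans hn.le
  have hlt : (M : ℝ) < (M - n) * K := by
    rw [← Nat.cast_sub hnM]
    exact_mod_cast (Nat.div_lt_iff_lt_mul hK).1
      (Nat.lt_sub_of_add_lt (by rwa [add_comm]) : M / K < M - n)
  have hmin : (n : ℝ) / M ≤ K * (1 - n / M) := by
    rw [one_sub_div hM.ne', mul_div_assoc', div_le_div_iff_of_pos_right hM]
    linarith [(Nat.cast_le (α := ℝ)).2 hnM]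
  rw [cutoffChar, min_eq_left hmin, mul_div_assoc]

lemma hsNorm_clock_sub_cutoffChar_le (M : ℕ) (κ : ℝ) {K : ℕ} (hK : 0 < K) :
    hsNorm (clock M κ - Matrix.diagonal fun n : Fin M => (cutoffChar κ K (n / M) : ℂ)) ≤
      √(4 / K) := by
  rcases M.eq_zero_or_pos with rfl | hM
  · rw [Subsingleton.elim (clock 0 κ - _) 0, map_zero]
    positivity
  refine (hsNorm_sub_le_of_col_eq (clock_mem_unitaryGroup M κ) (diagonal_mem_unitaryGroup _)
    (Finset.univ.filter fun n => M ≤ n + M / K) fun n hn i => ?_).trans (Real.sqrt_le_sqrt ?_)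
  · have hn' : n + M / K < M := by simpa using hn
    simp only [clock, Matrix.diagonal_apply]
    split_ifs with hin
    · rw [hin, cutoffChar_div_of_lt κ hK hn']
    · rfl
  · have hcard : ((Finset.univ.filter fun n : Fin M => M ≤ n + M / K).card : ℝ) ≤ M / K :=
      (Nat.cast_le.2 (card_filter_le_val_add M (M / K))).trans Nat.cast_div_le
    rw [Fintype.card_fin, div_le_iff₀ (by exact_mod_cast hM)]
    calc 4 * _ ≤ 4 * ((M : ℝ) / K) := by gcongr
      _ = 4 / K * M := by ring

lemma hsNorm_diagonal_sub_sum_clock_le (M : ℕ) {c : ℝ → ℂ} {s : Finset ℤ} {g : ℤ → ℂ} {ε : ℝ}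
    (hε : 0 ≤ ε) (hg : ∀ x ∈ Set.Ico (0 : ℝ) 1, ‖c x - ∑ m ∈ s, g m * 𝐞 (m * x)‖ ≤ ε) :
    hsNorm ((Matrix.diagonal fun n : Fin M => c (n / M)) - ∑ m ∈ s, g m • clock M m) ≤ ε := by
  have hsum : ∑ m ∈ s, g m • clock M m =
      Matrix.diagonal fun n : Fin M => ∑ m ∈ s, g m * (𝐞 (m * (n / M)) : ℂ) := by
    ext i j
    simp [clock, Matrix.sum_apply, Matrix.diagonal_apply, mul_div_assoc, Finset.sum_ite_irrel]
  rw [hsum, Matrix.diagonal_sub]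
  refine hsNorm_diagonal_le hε fun n => hg _ ⟨by positivity, ?_⟩
  rw [div_lt_one (by exact_mod_cast n.pos)]
  exact_mod_cast n.2

lemma exists_sum_clock_near (κ : ℝ) {ε : ℝ} (hε : 0 < ε) :
    ∃ (s : Finset ℤ) (g : ℤ → ℂ), ∀ M : ℕ,
      hsNorm (clock M κ - ∑ m ∈ s, g m • clock M m) ≤ ε := by
  obtain ⟨K, hK⟩ := exists_nat_gt (4 / (ε / 2) ^ 2)
  have hK' : (0 : ℝ) < K := lt_trans (by positivity) hK
  have hKε : √(4 / K) ≤ ε / 2 := by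
    rw [Real.sqrt_le_left (by positivity), div_le_comm₀ hK' (by positivity)]
    exact hK.le
  obtain ⟨s, g, hg⟩ := exists_sum_fourierChar_near (c := fun x => cutoffChar κ K x)
    (continuous_subtype_val.comp (continuous_cutoffChar κ K))
    (congr_arg Subtype.val (cutoffChar_zero_eq_one κ K)) (half_pos hε)
  refine ⟨s, g, fun M => ?_⟩
  calc hsNorm (clock M κ - ∑ m ∈ s, g m • clock M m) ≤ √(4 / K) + ε / 2 := by
        rw [← sub_add_sub_cancel _ (Matrix.diagonal fun n : Fin M => (cutoffChar κ K (n / M) : ℂ))]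
        exact (map_add_le_add _ _ _).trans <| add_le_add
          (hsNorm_clock_sub_cutoffChar_le M κ (by exact_mod_cast hK'))
          (hsNorm_diagonal_sub_sum_clock_le (c := fun x => cutoffChar κ K x) M (half_pos hε).le hg)
    _ ≤ ε := by linarith

/-! ### The quantised baker's map -/

lemma EvenPos.two_mul_half (N : EvenPos) : 2 * (N.1 / 2) = N.1 :=
  Nat.two_mul_div_two_of_even N.2.2

lemma EvenPos.half_pos (N : EvenPos) : 0 < N.1 / 2 := by
  have := N.two_mul_half
  have := N.2.1
  omega

lemma EvenPos.cast_eq (N : EvenPos) : (N.1 : ℝ) = 2 * ((N.1 / 2 : ℕ) : ℝ) := by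
  exact_mod_cast N.two_mul_half.symm

@[simp] lemma halves_inl (N : EvenPos) (i : Fin (N.1 / 2)) :
    ((halves N (Sum.inl i) : Fin N.1) : ℕ) = i := by
  simp [halves]

@[simp] lemma halves_inr (N : EvenPos) (i : Fin (N.1 / 2)) :
    ((halves N (Sum.inr i) : Fin N.1) : ℕ) = N.1 / 2 + i := by
  simp [halves, add_comm]

/-- The block matrix `X ⊕ X` acting on the two halves of the position basis, as a homomorphism of
star algebras. -/
def blk (N : EvenPos) : Matrix (Fin (N.1 / 2)) (Fin (N.1 / 2)) ℂ →⋆ₐ[ℂ]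
    Matrix (Fin N.1) (Fin N.1) ℂ where
  toFun X := (Matrix.fromBlocks X 0 0 X).reindex (halves N) (halves N)
  map_one' := by simp
  map_mul' X Y := by simp [Matrix.submatrix_mul_equiv, Matrix.fromBlocks_multiply]
  map_zero' := by simp
  map_add' X Y := by
    have h : Matrix.fromBlocks (X + Y) 0 0 (X + Y) =
        Matrix.fromBlocks X 0 0 X + Matrix.fromBlocks Y 0 0 Y := by simp [Matrix.fromBlocks_add]
    rw [h]
    rfl
  commutes' c := by
    rw [Matrix.algebraMap_eq_diagonal, Matrix.algebraMap_eq_diagonal, Matrix.fromBlocks_diagonal,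
      Matrix.reindex_apply, Matrix.submatrix_diagonal_equiv]
    congr 1
    funext n
    obtain ⟨s | s, rfl⟩ := (halves N).surjective n <;> simp
  map_star' X := by simp [Matrix.star_eq_conjTranspose, Matrix.fromBlocks_conjTranspose]

section Baker

variable {N : EvenPos}

lemma blk_apply (X : Matrix (Fin (N.1 / 2)) (Fin (N.1 / 2)) ℂ)
    (s t : Fin (N.1 / 2) ⊕ Fin (N.1 / 2)) :
    blk N X (halves N s) (halves N t) = Matrix.fromBlocks X 0 0 X s t := by
  simp [blk]

lemma hsNorm_blk (X : Matrix (Fin (N.1 / 2)) (Fin (N.1 / 2)) ℂ) :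
    hsNorm (blk N X) = hsNorm X := by
  have hsum : ∑ i, ∑ j, ‖blk N X i j‖ ^ 2 = 2 * ∑ i, ∑ j, ‖X i j‖ ^ 2 := by
    simp [← Equiv.sum_comp (halves N), blk_apply, Fintype.sum_sum_type, two_mul]
  rw [hsNorm_eq_sqrt_sum, hsNorm_eq_sqrt_sum, hsum, Fintype.card_fin, Fintype.card_fin, N.cast_eq,
    mul_div_mul_left _ _ two_ne_zero]

lemma blk_diagonal (d : Fin (N.1 / 2) → ℂ) :
    blk N (Matrix.diagonal d) =
      Matrix.diagonal (Sum.elim d d ∘ (halves N).symm) := by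
  change (Matrix.fromBlocks _ 0 0 _).reindex _ _ = _
  rw [Matrix.fromBlocks_diagonal, Matrix.reindex_apply, Matrix.submatrix_diagonal_equiv]

lemma blk_clock (N : EvenPos) (m : ℤ) :
    blk N (clock (N.1 / 2) m) = clock N.1 ((2 * m : ℤ) : ℝ) := by
  have hN : ((N.1 / 2 : ℕ) : ℝ) ≠ 0 := by exact_mod_cast N.half_pos.ne'
  rw [clock, blk_diagonal, clock]
  congr 1
  funext n
  obtain ⟨s, rfl⟩ := (halves N).surjective n
  rw [Function.comp_apply, Equiv.symm_apply_apply]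
  rcases s with s | s
  · rw [Sum.elim_inl, halves_inl, N.cast_eq]
    congr 2
    push_cast
    field_simp
  · rw [Sum.elim_inr, halves_inr, N.cast_eq]
    congr 1
    refine fourierChar_eq_of_sub_eq_intCast (-m) ?_
    push_cast
    field_simp
    ring

/-- Position `q ∈ [0, 1)` differs from half the doubled position by a function that is constant
on each of the two halves. -/
lemma clock_mul_blk_clock_eq (N : EvenPos) (κ : ℝ) :
    clock N.1 κ * blk N (clock (N.1 / 2) (-(κ / 2))) =
      Matrix.diagonal (Sum.elim (fun _ : Fin (N.1 / 2) => (1 : ℂ)) (fun _ => 𝐞 (κ / 2)) ∘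
        (halves N).symm) := by
  have hN : ((N.1 / 2 : ℕ) : ℝ) ≠ 0 := by exact_mod_cast N.half_pos.ne'
  rw [clock, clock, blk_diagonal, Matrix.diagonal_mul_diagonal]
  congr 1
  funext n
  obtain ⟨s, rfl⟩ := (halves N).surjective n
  simp only [Function.comp_apply, Equiv.symm_apply_apply]
  rcases s with s | s
  · rw [Sum.elim_inl, Sum.elim_inl, halves_inl, N.cast_eq, ← coe_fourierChar_add,
      fourierChar_eq_of_sub_eq_intCast (y := 0) 0 (by field_simp; push_cast; ring)]
    simp
  · rw [Sum.elim_inr, Sum.elim_inr, halves_inr, N.cast_eq, ← coe_fourierChar_add,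
      fourierChar_eq_of_sub_eq_intCast (y := κ / 2) 0 (by push_cast; field_simp; ring)]

lemma commute_clock_mul_blk_clock_blk (κ : ℝ) (X : Matrix (Fin (N.1 / 2)) (Fin (N.1 / 2)) ℂ) :
    Commute (clock N.1 κ * blk N (clock (N.1 / 2) (-(κ / 2)))) (blk N X) := by
  rw [clock_mul_blk_clock_eq]
  ext i j
  obtain ⟨s, rfl⟩ := (halves N).surjective i
  obtain ⟨t, rfl⟩ := (halves N).surjective j
  rw [Matrix.diagonal_mul, Matrix.mul_diagonal, blk_apply]
  rcases s with s | s <;> rcases t with t | t <;> simp [mul_comm]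

lemma momClock_neg_natCast_apply_of_lt {M m : ℕ} (i : Fin M) {j : Fin M} (hj : j + m < M) :
    momClock M (-m) i j = if (i : ℕ) = j + m then 1 else 0 := by
  rw [← Int.cast_natCast, ← Int.cast_neg, momClock_intCast_apply]
  congr 1
  refine propext ⟨fun h => ?_, fun h => by simp [h]⟩
  have := Int.eq_zero_of_abs_lt_dvd h (by rw [abs_lt]; omega)
  omega

lemma blk_momClock_neg_natCast_apply {m : ℕ} (i : Fin N.1) {t : Fin (N.1 / 2)}
    (ht : t + m < N.1 / 2) {b : Fin (N.1 / 2) ⊕ Fin (N.1 / 2)} (hb : b.elim id id = t) :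
    blk N (momClock (N.1 / 2) (-m)) i (halves N b) = momClock N.1 (-m) i (halves N b) := by
  obtain ⟨a, rfl⟩ := (halves N).surjective i
  have hN := N.two_mul_half
  rcases b with b | b <;> obtain rfl : b = t := hb
  all_goals
    rw [momClock_neg_natCast_apply_of_lt _ (by simp only [halves_inl, halves_inr]; omega),
      blk_apply]
    rcases a with a | a <;>
      simp only [Matrix.fromBlocks_apply₁₁, Matrix.fromBlocks_apply₁₂, Matrix.fromBlocks_apply₂₁,
        Matrix.fromBlocks_apply₂₂, Matrix.zero_apply, momClock_neg_natCast_apply_of_lt _ ht,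
        halves_inl, halves_inr]
  · exact (if_neg (by omega)).symm
  · exact (if_neg (by omega)).symm
  · simp only [add_assoc, add_right_inj]

lemma star_momClock (M : ℕ) (κ : ℝ) : star (momClock M κ) = momClock M (-κ) := by
  simp only [momClock, star_mul, star_star, star_clock, mul_assoc]

lemma hsNorm_blk_momClock_sub_le (N : EvenPos) (m : ℤ) :
    hsNorm (blk N (momClock (N.1 / 2) m) - momClock N.1 m) ≤ √(8 * |(m : ℝ)| / N.1) := by
  wlog hm : m ≤ 0 generalizing m
  · have h := this (-m) (by omega)
    push_cast at h
    rwa [abs_neg, ← star_momClock, ← star_momClock, map_star, ← star_sub, hsNorm_star] at h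
  obtain ⟨k, rfl⟩ := Int.exists_eq_neg_ofNat hm
  set T := Finset.univ.filter fun t : Fin (N.1 / 2) => N.1 / 2 ≤ t + k with hT
  push_cast
  refine (hsNorm_sub_le_of_col_eq (Unitary.map_mem (blk N) (momClock_mem_unitaryGroup _ _))
    (momClock_mem_unitaryGroup _ _) ((T.disjSum T).map (halves N).toEmbedding)
    fun j hj i => ?_).trans (Real.sqrt_le_sqrt ?_)
  · obtain ⟨b, rfl⟩ := (halves N).surjective j
    refine blk_momClock_neg_natCast_apply i (t := b.elim id id) ?_ rfl
    rcases b with b | b <;> simpa [hT] using hj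
  · have hcard : (T.card : ℝ) ≤ k := Nat.cast_le.2 (card_filter_le_val_add _ k)
    rw [Finset.card_map, Finset.card_disjSum, Fintype.card_fin, abs_neg, Nat.abs_cast]
    push_cast
    refine div_le_div_of_nonneg_right ?_ (by positivity)
    linarith

lemma bakerOp_eq (N : EvenPos) : bakerOp N = star (dft N.1) * blk N (dft (N.1 / 2)) := by
  rw [bakerOp, Matrix.inv_eq_left_inv (Matrix.mem_unitaryGroup_iff'.1 (dft_mem_unitaryGroup N.1))]
  rfl

lemma bakerOp_mem_unitaryGroup (N : EvenPos) : bakerOp N ∈ Matrix.unitaryGroup (Fin N.1) ℂ := by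
  rw [bakerOp_eq]
  exact mul_mem (Unitary.star_mem (dft_mem_unitaryGroup _))
    (Unitary.map_mem (blk N) (dft_mem_unitaryGroup _))

lemma star_bakerOp_mul_mul_bakerOp (A : Matrix (Fin N.1) (Fin N.1) ℂ) :
    star (bakerOp N) * A * bakerOp N =
      blk N (star (dft (N.1 / 2))) * (dft N.1 * A * star (dft N.1)) * blk N (dft (N.1 / 2)) := by
  rw [bakerOp_eq, star_mul, star_star, ← map_star]
  simp only [mul_assoc]

lemma hsNorm_star_bakerOp_mul_clock_mul_bakerOp_sub_le (N : EvenPos) (m : ℤ) :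
    hsNorm (star (bakerOp N) * clock N.1 m * bakerOp N - clock N.1 ((2 * m : ℤ) : ℝ)) ≤
      √(8 * |(m : ℝ)| / N.1) := by
  have hdft := dft_mem_unitaryGroup (N.1 / 2)
  have hclock : clock (N.1 / 2) m =
      star (dft (N.1 / 2)) * momClock (N.1 / 2) (-m) * dft (N.1 / 2) := by
    rw [← dft_mul_clock_mul_star_dft]
    simp only [mul_assoc, Unitary.star_mul_self_of_mem hdft, mul_one]
    rw [← mul_assoc, Unitary.star_mul_self_of_mem hdft, one_mul]
  have h := hsNorm_blk_momClock_sub_le N (-m)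
  push_cast at h
  rw [star_bakerOp_mul_mul_bakerOp, dft_mul_clock_mul_star_dft, ← blk_clock, hclock, map_mul,
    map_mul, ← sub_mul, ← mul_sub, hsNorm_mul_unitary (Unitary.map_mem (blk N) hdft),
    hsNorm_unitary_mul (Unitary.map_mem (blk N) (Unitary.star_mem hdft)), map_sub_rev]
  rwa [abs_neg] at h

lemma star_bakerOp_mul_momClock_mul_bakerOp (N : EvenPos) (κ : ℝ) :
    star (bakerOp N) * momClock N.1 κ * bakerOp N =
      clock N.1 κ * blk N (clock (N.1 / 2) (-(κ / 2))) * blk N (momClock (N.1 / 2) (κ / 2)) := by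
  have hconj : dft N.1 * momClock N.1 κ * star (dft N.1) = clock N.1 κ := by
    have := Unitary.mul_star_self_of_mem (dft_mem_unitaryGroup N.1)
    simp only [momClock, mul_assoc, this, mul_one]
    rw [← mul_assoc, this, one_mul]
  have hclock : clock N.1 κ = clock N.1 κ * blk N (clock (N.1 / 2) (-(κ / 2))) *
      blk N (clock (N.1 / 2) (κ / 2)) := by
    rw [mul_assoc, ← map_mul, ← clock_add, neg_add_cancel, clock_zero, map_one, mul_one]
  rw [star_bakerOp_mul_mul_bakerOp, hconj, hclock, ← mul_assoc,
    ← (commute_clock_mul_blk_clock_blk κ _).eq, ← hclock, momClock, map_mul, map_mul]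
  simp only [mul_assoc]

end Baker

/-! ### Operator sequences and their evolution -/

/-- The sequences of operators, one on each quantum space. -/
abbrev OpSeq : Type := ∀ N : EvenPos, Matrix (Fin N.1) (Fin N.1) ℂ

/-- The operator sequences whose normalised Hilbert–Schmidt norm tends to `0`. -/
abbrev negligibleSeqs : Submodule ℂ OpSeq := nullFamilies atTop fun _ => hsNorm

/-- The functions `e^{2πiκq}` of the position. -/
def clockSeq (κ : ℝ) : OpSeq := fun N => clock N.1 κ

/-- The functions `e^{2πiκp}` of the momentum. -/
def momSeq (κ : ℝ) : OpSeq := fun N => momClock N.1 κ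

/-- The functions `e^{2πiκ{2q}}` of the position, with `{2q}` the fractional part. -/
def blkClockSeq (κ : ℝ) : OpSeq := fun N => blk N (clock (N.1 / 2) κ)

/-- The functions of the position: the asymptotic closure of the trigonometric polynomials
in `q`. -/
def positionSeqs : Submodule ℂ OpSeq :=
  asympClosure atTop (fun _ => hsNorm) (Submodule.span ℂ (Set.range fun m : ℤ => clockSeq m))

lemma mem_unitary_opSeq {A : OpSeq} :
    A ∈ unitary OpSeq ↔ ∀ N, A N ∈ Matrix.unitaryGroup (Fin N.1) ℂ :=
  ⟨fun h N => Unitary.mem_iff.2 ⟨congr_fun h.1 N, congr_fun h.2 N⟩,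
    fun h => Unitary.mem_iff.2 ⟨funext fun N => (h N).1, funext fun N => (h N).2⟩⟩

lemma clockSeq_mem_unitary (κ : ℝ) : clockSeq κ ∈ unitary OpSeq :=
  mem_unitary_opSeq.2 fun _ => clock_mem_unitaryGroup _ κ

lemma blkClockSeq_mem_unitary (κ : ℝ) : blkClockSeq κ ∈ unitary OpSeq :=
  mem_unitary_opSeq.2 fun N => Unitary.map_mem (blk N) (clock_mem_unitaryGroup _ κ)

/-- The Heisenberg evolution `A ↦ B⁻¹ A B` of operator sequences under the baker's map. -/
def heis : OpSeq ≃⋆ₐ[ℂ] OpSeq :=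
  Unitary.conjStarAlgAut ℂ OpSeq (star ⟨bakerOp, mem_unitary_opSeq.2 bakerOp_mem_unitaryGroup⟩)

lemma heis_apply (A : OpSeq) (N : EvenPos) :
    heis A N = star (bakerOp N) * A N * bakerOp N := by
  simp [heis, Unitary.conjStarAlgAut_apply]

lemma hsNorm_heis_apply (A : OpSeq) (N : EvenPos) : hsNorm (heis A N) = hsNorm (A N) := by
  have hB := bakerOp_mem_unitaryGroup N
  rw [heis_apply, hsNorm_mul_unitary hB, hsNorm_unitary_mul (Unitary.star_mem hB)]

section Negligible

variable {A U : OpSeq}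

lemma mul_mem_negligibleSeqs (hU : U ∈ unitary OpSeq) (hA : A ∈ negligibleSeqs) :
    U * A ∈ negligibleSeqs := by
  simpa only [mem_nullFamilies, Pi.mul_apply, hsNorm_unitary_mul (mem_unitary_opSeq.1 hU _)]
    using hA

lemma tendsto_coe_evenPos : Tendsto (fun N : EvenPos => (N.1 : ℝ)) atTop atTop :=
  tendsto_atTop.2 fun b =>
    (eventually_ge_atTop (⟨2 * (⌈b⌉₊ + 1), by omega, even_two_mul _⟩ : EvenPos)).mono fun N hN =>
      (Nat.le_ceil b).trans (Nat.cast_le.2 ((show ⌈b⌉₊ ≤ 2 * (⌈b⌉₊ + 1) by omega).trans hN))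

lemma mem_negligibleSeqs_of_hsNorm_le_sqrt {C : ℝ} (h : ∀ N, hsNorm (A N) ≤ √(C / N.1)) :
    A ∈ negligibleSeqs := by
  refine mem_nullFamilies_of_le ?_ h
  simpa using (tendsto_coe_evenPos.const_div_atTop C).sqrt

end Negligible

lemma hsNorm_momClock_sub_sum_momClock (M : ℕ) (κ : ℝ) (s : Finset ℤ) (g : ℤ → ℂ) :
    hsNorm (momClock M κ - ∑ m ∈ s, g m • momClock M m) =
      hsNorm (clock M κ - ∑ m ∈ s, g m • clock M m) := by
  have hF := dft_mem_unitaryGroup M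
  rw [← hsNorm_mul_unitary hF (clock M κ - _),
    ← hsNorm_unitary_mul (Unitary.star_mem hF) ((clock M κ - _) * _)]
  simp only [momClock, sub_mul, mul_sub, Finset.sum_mul, Finset.mul_sum, smul_mul_assoc,
    mul_smul_comm, mul_assoc]

/-- Cutting the torus along `q = 1/2` does not matter semiclassically for functions of the
momentum. -/
lemma blkMomSeq_sub_momSeq_mem_negligibleSeqs (κ : ℝ) :
    (fun N => blk N (momClock (N.1 / 2) κ)) - momSeq κ ∈ negligibleSeqs := by
  rw [negligibleSeqs, nullFamilies, ← asympClosure_idem]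
  intro ε hε
  obtain ⟨s, g, hsg⟩ := exists_sum_clock_near κ (half_pos hε)
  refine ⟨∑ m ∈ s, g m • ((fun N => blk N (momClock (N.1 / 2) m)) - momSeq m),
    Submodule.sum_mem _ fun m _ => Submodule.smul_mem _ _
      (mem_negligibleSeqs_of_hsNorm_le_sqrt (hsNorm_blk_momClock_sub_le · m)),
    Eventually.of_forall fun N => ?_⟩
  have hsplit : ((fun N => blk N (momClock (N.1 / 2) κ)) - momSeq κ) N -
      (∑ m ∈ s, g m • ((fun N => blk N (momClock (N.1 / 2) m)) - momSeq m)) N =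
      blk N (momClock (N.1 / 2) κ - ∑ m ∈ s, g m • momClock (N.1 / 2) m) -
        (momClock N.1 κ - ∑ m ∈ s, g m • momClock N.1 m) := by
    simp only [momSeq, Pi.sub_apply, Finset.sum_apply, Pi.smul_apply, smul_sub,
      Finset.sum_sub_distrib, map_sub, map_sum, map_smul]
    abel
  calc hsNorm _ ≤ ε / 2 + ε / 2 := by
        rw [hsplit]
        refine (map_sub_le_add _ _ _).trans (add_le_add ?_ ?_)
        · rw [hsNorm_blk, hsNorm_momClock_sub_sum_momClock]
          exact hsg _
        · rw [hsNorm_momClock_sub_sum_momClock]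
          exact hsg _
    _ = ε := add_halves ε

lemma heis_clockSeq_sub_mem_negligibleSeqs (m : ℤ) :
    heis (clockSeq m) - clockSeq ((2 * m : ℤ) : ℝ) ∈ negligibleSeqs :=
  mem_negligibleSeqs_of_hsNorm_le_sqrt fun N => by
    rw [Pi.sub_apply, heis_apply]
    exact hsNorm_star_bakerOp_mul_clock_mul_bakerOp_sub_le N m

lemma heis_momSeq_sub_mem_negligibleSeqs (κ : ℝ) :
    heis (momSeq κ) - clockSeq κ * blkClockSeq (-(κ / 2)) * momSeq (κ / 2) ∈ negligibleSeqs := by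
  have hheis : heis (momSeq κ) =
      clockSeq κ * blkClockSeq (-(κ / 2)) * fun N => blk N (momClock (N.1 / 2) (κ / 2)) :=
    funext fun N => (heis_apply _ N).trans (star_bakerOp_mul_momClock_mul_bakerOp N κ)
  rw [hheis, ← mul_sub]
  exact mul_mem_negligibleSeqs (mul_mem (clockSeq_mem_unitary _) (blkClockSeq_mem_unitary _))
    (blkMomSeq_sub_momSeq_mem_negligibleSeqs _)

section Position

variable {A B : OpSeq}

lemma clockSeq_intCast_mem_positionSeqs (m : ℤ) : clockSeq m ∈ positionSeqs :=
  le_asympClosure (Submodule.subset_span ⟨m, rfl⟩)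

lemma positionSeqs_closed
    (h : ∀ ε > 0, ∃ B ∈ positionSeqs, ∀ N, hsNorm (A N - B N) ≤ ε) : A ∈ positionSeqs := by
  rw [positionSeqs, ← asympClosure_idem]
  exact fun ε hε => (h ε hε).imp fun _ hB => ⟨hB.1, Eventually.of_forall hB.2⟩

lemma clockSeq_mem_positionSeqs (κ : ℝ) : clockSeq κ ∈ positionSeqs :=
  positionSeqs_closed fun ε hε => by
    obtain ⟨s, g, hsg⟩ := exists_sum_clock_near κ hε
    refine ⟨∑ m ∈ s, g m • clockSeq m, Submodule.sum_mem _ fun m _ =>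
      Submodule.smul_mem _ _ (clockSeq_intCast_mem_positionSeqs m), fun N => ?_⟩
    simpa [clockSeq] using hsg N.1

lemma blkClockSeq_mem_positionSeqs (κ : ℝ) : blkClockSeq κ ∈ positionSeqs :=
  positionSeqs_closed fun ε hε => by
    obtain ⟨s, g, hsg⟩ := exists_sum_clock_near κ hε
    refine ⟨∑ m ∈ s, g m • clockSeq ((2 * m : ℤ) : ℝ), Submodule.sum_mem _ fun m _ =>
      Submodule.smul_mem _ _ (clockSeq_intCast_mem_positionSeqs _), fun N => ?_⟩
    rw [Finset.sum_apply]
    simp only [blkClockSeq, clockSeq, Pi.smul_apply, ← blk_clock]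
    simpa using (hsNorm_blk _).trans_le (hsg (N.1 / 2))

lemma map_mem_positionSeqs (L : OpSeq →ₗ[ℂ] OpSeq) (hL : ∀ A N, hsNorm (L A N) = hsNorm (A N))
    (h : ∀ m : ℤ, L (clockSeq m) ∈ positionSeqs) (hA : A ∈ positionSeqs) : L A ∈ positionSeqs :=
  map_mem_asympClosure L (C := 1) (fun A N => by rw [hL, one_mul])
    (Submodule.span_le.2 (Set.range_subset_iff.2 h)) hA

lemma mul_mem_positionSeqs (hA : A ∈ positionSeqs) (hB : B ∈ positionSeqs)
    (hBu : B ∈ unitary OpSeq) : A * B ∈ positionSeqs := by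
  refine map_mem_positionSeqs (LinearMap.mulRight ℂ B)
    (fun A N => hsNorm_mul_unitary (mem_unitary_opSeq.1 hBu N) (A N)) (fun m => ?_) hA
  refine map_mem_positionSeqs (LinearMap.mulLeft ℂ (clockSeq m))
    (fun A N => hsNorm_unitary_mul (clock_mem_unitaryGroup N.1 m) (A N)) (fun n => ?_) hB
  have hmn : clockSeq m * clockSeq n = clockSeq ((m + n : ℤ) : ℝ) :=
    funext fun N => by simp [clockSeq, clock_add]
  rw [LinearMap.mulLeft_apply, hmn]
  exact clockSeq_intCast_mem_positionSeqs _

lemma heis_mem_positionSeqs (hA : A ∈ positionSeqs) : heis A ∈ positionSeqs :=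
  map_mem_positionSeqs heis.toAlgEquiv.toLinearMap hsNorm_heis_apply
    (fun m => mem_asympClosure_of_sub_mem (clockSeq_intCast_mem_positionSeqs _)
      (heis_clockSeq_sub_mem_negligibleSeqs m)) hA

end Position

/-! ### Mean deviation of the diagonal matrix elements -/

section Expectation

variable {n : ℕ}

lemma expectation_eq_dotProduct (A : Matrix (Fin n) (Fin n) ℂ) (ψ : QState n) :
    expectation A ψ = star ψ.ofLp ⬝ᵥ A.mulVec ψ.ofLp := by
  rw [expectation, EuclideanSpace.inner_eq_star_dotProduct, dotProduct_comm]
  rfl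

/-- The expectation in the state `ψ`, as a linear form in the operator. -/
def expectationForm (ψ : QState n) : Matrix (Fin n) (Fin n) ℂ →ₗ[ℂ] ℂ :=
  (innerSL ℂ ψ).toLinearMap ∘ₗ LinearMap.applyₗ ψ ∘ₗ Matrix.toEuclideanLin.toLinearMap

@[simp] lemma expectationForm_apply (ψ : QState n) (A : Matrix (Fin n) (Fin n) ℂ) :
    expectationForm ψ A = expectation A ψ := rfl

lemma norm_expectation_le_one {U : Matrix (Fin n) (Fin n) ℂ}
    (hU : U ∈ Matrix.unitaryGroup (Fin n) ℂ) {ψ : QState n} (hψ : ‖ψ‖ = 1) :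
    ‖expectation U ψ‖ ≤ 1 := by
  have hnorm : ‖Matrix.toEuclideanCLM (𝕜 := ℂ) U ψ‖ = ‖ψ‖ :=
    ContinuousLinearMap.norm_map_of_mem_unitary (Unitary.map_mem Matrix.toEuclideanCLM hU) ψ
  calc ‖expectation U ψ‖ ≤ ‖ψ‖ * ‖Matrix.toEuclideanCLM (𝕜 := ℂ) U ψ‖ := norm_inner_le_norm _ _
    _ = 1 := by rw [hnorm, hψ, one_mul]

/-- The deviation of `⟨ψ, Aψ⟩` from the normalised trace of `A`, as a linear form in `A`. -/
def expectationDev (ψ : QState n) : Matrix (Fin n) (Fin n) ℂ →ₗ[ℂ] ℂ :=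
  expectationForm ψ - (n : ℂ)⁻¹ • Matrix.traceLinearMap (Fin n) ℂ ℂ

lemma expectationDev_apply (ψ : QState n) (A : Matrix (Fin n) (Fin n) ℂ) :
    expectationDev ψ A = expectation A ψ - A.trace / n := by
  rw [div_eq_inv_mul]
  rfl

/-- The mean over `j` of the absolute deviation of `⟨φ j, A (φ j)⟩` from the normalised trace
of `A`. -/
def meanDev (φ : Fin n → QState n) : Seminorm ℂ (Matrix (Fin n) (Fin n) ℂ) :=
  (n : NNReal)⁻¹ • ∑ j, (normSeminorm ℂ ℂ).comp (expectationDev (φ j))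

lemma meanDev_apply (φ : Fin n → QState n) (A : Matrix (Fin n) (Fin n) ℂ) :
    meanDev φ A = (∑ j, ‖expectationDev (φ j) A‖) / n := by
  rw [meanDev, smul_apply, sum_apply, NNReal.smul_def, smul_eq_mul, div_eq_inv_mul]
  rfl

/-- The matrix whose columns are the vectors of the basis `φ`. -/
def basisMatrix (φ : OrthonormalBasis (Fin n) ℂ (QState n)) : Matrix (Fin n) (Fin n) ℂ :=
  Matrix.of fun i j => φ j i

variable (φ : OrthonormalBasis (Fin n) ℂ (QState n)) (A : Matrix (Fin n) (Fin n) ℂ)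

lemma basisMatrix_mem_unitaryGroup : basisMatrix φ ∈ Matrix.unitaryGroup (Fin n) ℂ :=
  (EuclideanSpace.basisFun (Fin n) ℂ).toMatrix_orthonormalBasis_mem_unitary φ

lemma expectation_eq_conj_basisMatrix (j : Fin n) :
    expectation A (φ j) = (star (basisMatrix φ) * A * basisMatrix φ) j j := by
  rw [expectation_eq_dotProduct, mul_assoc]
  rfl

lemma sum_expectation_eq_trace : ∑ j, expectation A (φ j) = A.trace := by
  simp only [expectation_eq_conj_basisMatrix]
  change (star (basisMatrix φ) * A * basisMatrix φ).trace = _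
  rw [Matrix.trace_mul_comm, ← mul_assoc,
    Unitary.mul_star_self_of_mem (basisMatrix_mem_unitaryGroup φ), one_mul]

lemma sum_norm_expectation_div_le_hsNorm : (∑ j, ‖expectation A (φ j)‖) / n ≤ hsNorm A := by
  have hφ := basisMatrix_mem_unitaryGroup φ
  rw [← hsNorm_unitary_mul (Unitary.star_mem hφ), ← hsNorm_mul_unitary hφ]
  simp only [expectation_eq_conj_basisMatrix]
  set E := star (basisMatrix φ) * A * basisMatrix φ
  rw [hsNorm_eq_sqrt_sum, Fintype.card_fin, Real.le_sqrt (by positivity) (by positivity), div_pow]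
  calc (∑ j, ‖E j j‖) ^ 2 / (n : ℝ) ^ 2 ≤ (n * ∑ j, ‖E j j‖ ^ 2) / (n : ℝ) ^ 2 := by
        gcongr
        simpa using sq_sum_le_card_mul_sum_sq (s := Finset.univ) (f := fun j => ‖E j j‖)
    _ = (∑ j, ‖E j j‖ ^ 2) / n := by
        rcases eq_or_ne (n : ℝ) 0 with hn | hn
        · simp [hn]
        · field_simp
    _ ≤ _ := by
        gcongr with i
        exact Finset.single_le_sum (f := fun j => ‖E i j‖ ^ 2) (fun _ _ => by positivity)
          (Finset.mem_univ i)

lemma meanDev_le_two_mul_hsNorm : meanDev φ A ≤ 2 * hsNorm A := by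
  have hmean := sum_norm_expectation_div_le_hsNorm φ A
  have htrace : ‖A.trace / n‖ ≤ hsNorm A := by
    rw [← sum_expectation_eq_trace φ, norm_div, Complex.norm_natCast]
    exact (div_le_div_of_nonneg_right (norm_sum_le _ _) n.cast_nonneg).trans hmean
  rw [meanDev_apply]
  simp only [expectationDev_apply]
  calc (∑ j, ‖expectation A (φ j) - A.trace / n‖) / n
      ≤ (∑ j, (‖expectation A (φ j)‖ + ‖A.trace / n‖)) / n := by
        gcongr
        exact norm_sub_le _ _
    _ = (∑ j, ‖expectation A (φ j)‖) / n + n / n * ‖A.trace / n‖ := by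
        rw [Finset.sum_add_distrib, add_div, Finset.sum_const, Finset.card_fin, nsmul_eq_mul]
        ring
    _ ≤ 2 * hsNorm A := by
        have := mul_le_of_le_one_left (norm_nonneg (A.trace / n)) (div_self_le_one (n : ℝ))
        linarith

lemma expectation_one {ψ : QState n} (hψ : ‖ψ‖ = 1) :
    expectation (1 : Matrix (Fin n) (Fin n) ℂ) ψ = 1 := by
  simp [expectation, hψ]

lemma meanDev_one (hn : n ≠ 0) : meanDev φ 1 = 0 := by
  simp [meanDev_apply, expectationDev_apply, expectation_one, hn]

lemma expectation_conj_of_eigenvector {U : Matrix (Fin n) (Fin n) ℂ}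
    (hU : U ∈ Matrix.unitaryGroup (Fin n) ℂ) {ψ : QState n} (hψ : ‖ψ‖ = 1) {μ : ℂ}
    (hμ : Matrix.toEuclideanLin U ψ = μ • ψ) :
    expectation (star U * A * U) ψ = expectation A ψ := by
  have hconj : ∀ X, expectation (star U * X * U) ψ = star μ * μ * expectation X ψ := by
    intro X
    have hμ' : U.mulVec ψ.ofLp = μ • ψ.ofLp := congrArg WithLp.ofLp hμ
    rw [expectation_eq_dotProduct, expectation_eq_dotProduct, mul_assoc, ← Matrix.mulVec_mulVec,
      Matrix.dotProduct_mulVec, Matrix.star_eq_conjTranspose, ← Matrix.star_mulVec,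
      ← Matrix.mulVec_mulVec, hμ', star_smul, Matrix.mulVec_smul, smul_dotProduct, dotProduct_smul,
      smul_smul, smul_eq_mul]
  have hnorm : star μ * μ = 1 := by
    simpa only [mul_one, Unitary.star_mul_self_of_mem hU, expectation_one hψ] using
      (hconj 1).symm
  rw [hconj, hnorm, one_mul]

end Expectation

/-! ### Quantum ergodicity of the observables -/

lemma hsNorm_sum_clock {M : ℕ} (hM : M ≠ 0) {α : Type*} (s : Finset α) (k : α → ℤ)
    (hk : ∀ a ∈ s, ∀ b ∈ s, (M : ℤ) ∣ k a - k b → a = b) :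
    hsNorm (∑ a ∈ s, clock M (k a)) = √s.card := by
  classical
  have htrace : (star (∑ a ∈ s, clock M (k a)) * ∑ a ∈ s, clock M (k a)).trace =
      (M * s.card : ℝ) := by
    have hterm : ∀ a ∈ s, ∀ b ∈ s,
        (star (clock M (k a)) * clock M (k b)).trace = if a = b then (M : ℂ) else 0 := by
      intro a ha b hb
      rw [star_clock, ← clock_add, neg_add_eq_sub, ← Int.cast_sub, trace_clock]
      refine if_congr ⟨fun h => (hk b hb a ha h).symm, ?_⟩ rfl rfl
      rintro rfl
      simp
    rw [star_sum, Finset.sum_mul_sum, Matrix.trace_sum]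
    simp only [Matrix.trace_sum]
    rw [Finset.sum_congr rfl fun a ha => Finset.sum_congr rfl (hterm a ha)]
    simp [Finset.sum_ite_eq, mul_comm]
  rw [← sq_eq_sq₀ (apply_nonneg _ _) (Real.sqrt_nonneg _), Real.sq_sqrt (Nat.cast_nonneg _),
    ← Complex.ofReal_inj, hsNorm_sq_eq_trace, htrace, Fintype.card_fin]
  push_cast
  exact mul_div_cancel_left₀ _ (Nat.cast_ne_zero.2 hM)

lemma hsNorm_avg_clock_two_pow {m : ℤ} (hm : m ≠ 0) {M n : ℕ} (hM : 2 ^ n * |m| < M) :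
    hsNorm ((n : ℂ)⁻¹ • ∑ t ∈ Finset.range n, clock M ((2 ^ t * m : ℤ) : ℝ)) = (√n)⁻¹ := by
  have hpow : ∀ t ∈ Finset.range n, (2 : ℤ) ^ t < 2 ^ n := fun t ht =>
    pow_lt_pow_right₀ one_lt_two (Finset.mem_range.1 ht)
  have hinj : ∀ t ∈ Finset.range n, ∀ s ∈ Finset.range n,
      (M : ℤ) ∣ 2 ^ t * m - 2 ^ s * m → t = s := by
    intro t ht s hs h
    rw [← sub_mul] at h
    have hlt : |(2 ^ t - 2 ^ s : ℤ)| < 2 ^ n :=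
      abs_sub_lt_of_nonneg_of_lt (by positivity) (hpow t ht) (by positivity) (hpow s hs)
    have hzero := Int.eq_zero_of_abs_lt_dvd h <| by
      rw [abs_mul]
      exact (mul_lt_mul_of_pos_right hlt (abs_pos.2 hm)).trans hM
    exact Int.pow_right_injective (by norm_num : 1 < Int.natAbs 2)
      (sub_eq_zero.1 ((mul_eq_zero.1 hzero).resolve_right hm))
  have hM0 : M ≠ 0 := by
    rintro rfl
    exact absurd hM (not_lt.2 (by positivity))
  rw [map_smul_eq_mul, hsNorm_sum_clock hM0 _ _ hinj, Finset.card_range, norm_inv,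
    Complex.norm_natCast, ← div_eq_inv_mul, Real.sqrt_div_self]

lemma weylTranslation_eq_smul (M : ℕ) (k : ℤ × ℤ) :
    weylTranslation M k =
      (𝐞 (-(k.1 * k.2) / (2 * M)) : ℂ) • (clock M k.2 * momClock M (-k.1)) := by
  ext i j
  have hiff : ((i : ℕ) : ℤ) ≡ (j : ℕ) + k.1 [ZMOD M] ↔ (M : ℤ) ∣ i + -k.1 - j := by
    rw [Int.modEq_comm, Int.modEq_iff_dvd, ← sub_eq_add_neg, sub_right_comm, sub_sub]
  rw [Matrix.smul_apply, clock, Matrix.diagonal_mul, ← Int.cast_neg, momClock_intCast_apply,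
    weylTranslation, Matrix.of_apply]
  simp only [hiff, Real.fourierChar_apply, smul_eq_mul, mul_ite, mul_one, mul_zero]
  congr 3 <;>
  · push_cast
    ring

lemma weylTranslation_mem_unitaryGroup (M : ℕ) (k : ℤ × ℤ) :
    weylTranslation M k ∈ Matrix.unitaryGroup (Fin M) ℂ := by
  rw [weylTranslation_eq_smul]
  refine Unitary.smul_mem_of_mem (Unitary.mem_iff.2 ?_)
    (mul_mem (clock_mem_unitaryGroup _ _) (momClock_mem_unitaryGroup _ _))
  rw [star_fourierChar, ← coe_fourierChar_add, ← coe_fourierChar_add]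
  simp

lemma trace_weylTranslation_eq_zero {k : ℤ × ℤ} (hk : k ≠ 0) {M : ℕ} (hM : |k.1| + |k.2| < M) :
    (weylTranslation M k).trace = 0 := by
  have hdvd : ∀ m : ℤ, |m| ≤ |k.1| + |k.2| → (M : ℤ) ∣ m → m = 0 := fun m hm h =>
    Int.eq_zero_of_abs_lt_dvd h (hm.trans_lt hM)
  rw [weylTranslation_eq_smul, Matrix.trace_smul]
  by_cases h₁ : k.1 = 0
  · have h₂ : ¬ (M : ℤ) ∣ k.2 := fun h =>
      hk (Prod.ext h₁ (hdvd _ (le_add_of_nonneg_left (abs_nonneg _)) h))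
    rw [h₁, Int.cast_zero, neg_zero, momClock_zero, mul_one, trace_clock, if_neg h₂, smul_zero]
  · have h : ∀ i, (clock M k.2 * momClock M (-k.1)) i i = 0 := fun i => by
      rw [clock, Matrix.diagonal_mul, ← Int.cast_neg, momClock_intCast_apply, if_neg, mul_zero]
      rw [add_sub_cancel_left, dvd_neg]
      exact fun h => h₁ (hdvd _ (le_add_of_nonneg_right (abs_nonneg _)) h)
    rw [Matrix.trace, Finset.sum_eq_zero fun i _ => (Matrix.diag_apply _ _).trans (h i),
      smul_zero]

section Ergodic

variable (φ : ∀ N : EvenPos, OrthonormalBasis (Fin N.1) ℂ (QState N.1)) {A : OpSeq}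

/-- The operator sequences whose diagonal matrix elements in the bases `φ N` are, for most of the
basis vectors, close to the normalised trace. -/
abbrev ergodicSeqs : Submodule ℂ OpSeq := nullFamilies atTop fun N => meanDev (φ N)

lemma asympClosure_ergodicSeqs_le :
    asympClosure atTop (fun _ => hsNorm) (ergodicSeqs φ) ≤ ergodicSeqs φ := fun _ hA =>
  map_mem_asympClosure LinearMap.id (C := 2) (fun A N => meanDev_le_two_mul_hsNorm (φ N) (A N))
    le_rfl hA

lemma negligibleSeqs_le_ergodicSeqs : negligibleSeqs ≤ ergodicSeqs φ :=
  nullFamilies_le_asympClosure.trans (asympClosure_ergodicSeqs_le φ)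

lemma one_mem_ergodicSeqs : 1 ∈ ergodicSeqs φ :=
  mem_nullFamilies_of_le tendsto_const_nhds fun N => (meanDev_one (φ N) N.2.1.ne').le

variable (hφ : ∀ (N : EvenPos) (j : Fin N.1), ∃ μ : ℂ,
  Matrix.toEuclideanLin (bakerOp N) (φ N j) = μ • φ N j)

include hφ

variable {φ}

lemma heis_sub_mem_ergodicSeqs (A : OpSeq) : heis A - A ∈ ergodicSeqs φ := by
  refine mem_nullFamilies_of_le tendsto_const_nhds fun N => le_of_eq (b := 0) ?_
  have htrace : (heis A N).trace = (A N).trace := by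
    rw [heis_apply, Matrix.trace_mul_comm, ← mul_assoc,
      Unitary.mul_star_self_of_mem (bakerOp_mem_unitaryGroup N), one_mul]
  have hexp : ∀ j, expectation (heis A N) (φ N j) = expectation (A N) (φ N j) := fun j => by
    obtain ⟨μ, hμ⟩ := hφ N j
    rw [heis_apply]
    exact expectation_conj_of_eigenvector _ (bakerOp_mem_unitaryGroup N) ((φ N).norm_eq_one j) hμ
  have hdev : ∀ j, expectationDev (φ N j) (heis A N - A N) = 0 := fun j => by
    rw [map_sub, sub_eq_zero]
    rw [expectationDev_apply, expectationDev_apply, hexp, htrace]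
  rw [meanDev_apply, Pi.sub_apply]
  simp only [hdev, norm_zero, Finset.sum_const_zero, zero_div]

lemma clockSeq_sub_clockSeq_two_pow_mem_ergodicSeqs (m : ℤ) (t : ℕ) :
    clockSeq m - clockSeq ((2 ^ t * m : ℤ) : ℝ) ∈ ergodicSeqs φ := by
  induction t with
  | zero => simp
  | succ t ih =>
    have h := sub_mem (negligibleSeqs_le_ergodicSeqs φ
      (heis_clockSeq_sub_mem_negligibleSeqs (2 ^ t * m)))
      (heis_sub_mem_ergodicSeqs hφ (clockSeq ((2 ^ t * m : ℤ) : ℝ)))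
    rw [sub_sub_sub_cancel_left, ← mul_assoc, ← pow_succ'] at h
    simpa only [sub_add_sub_cancel] using add_mem ih h

/-- Frequency doubling turns `e^{2πimq}` into an average of `n` orthogonal terms, whose norm is
`n^{-1/2}`. -/
lemma clockSeq_intCast_mem_ergodicSeqs (m : ℤ) : clockSeq m ∈ ergodicSeqs φ := by
  rcases eq_or_ne m 0 with rfl | hm
  · have h : clockSeq ((0 : ℤ) : ℝ) = 1 := funext fun N => by simp [clockSeq, clock_zero]
    exact h ▸ one_mem_ergodicSeqs φ
  refine asympClosure_ergodicSeqs_le φ fun ε hε => ?_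
  obtain ⟨n, hn⟩ := exists_nat_gt ((ε⁻¹) ^ 2)
  have hn0 : (0 : ℝ) < n := lt_trans (by positivity) hn
  refine ⟨(n : ℂ)⁻¹ • ∑ t ∈ Finset.range n, (clockSeq m - clockSeq ((2 ^ t * m : ℤ) : ℝ)),
    Submodule.smul_mem _ _ (Submodule.sum_mem _ fun t _ =>
      clockSeq_sub_clockSeq_two_pow_mem_ergodicSeqs hφ m t), ?_⟩
  filter_upwards [tendsto_coe_evenPos.eventually_gt_atTop ((2 ^ n * |m| : ℤ) : ℝ)] with N hN
  have hsub : clockSeq m N - ((n : ℂ)⁻¹ • ∑ t ∈ Finset.range n,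
      (clockSeq m - clockSeq ((2 ^ t * m : ℤ) : ℝ))) N =
      (n : ℂ)⁻¹ • ∑ t ∈ Finset.range n, clock N.1 ((2 ^ t * m : ℤ) : ℝ) := by
    rw [Pi.smul_apply, Finset.sum_apply]
    simp only [Pi.sub_apply, Finset.sum_sub_distrib, smul_sub, Finset.sum_const, Finset.card_range,
      ← Nat.cast_smul_eq_nsmul ℂ, smul_smul, clockSeq]
    rw [inv_mul_cancel₀ (by exact_mod_cast hn0.ne'), one_smul, sub_sub_cancel]
  rw [hsub, hsNorm_avg_clock_two_pow hm (by exact_mod_cast hN)]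
  exact inv_le_of_inv_le₀ hε (Real.le_sqrt_of_sq_le hn.le)

lemma positionSeqs_le_ergodicSeqs : positionSeqs ≤ ergodicSeqs φ :=
  (asympClosure_mono (Submodule.span_le.2 (Set.range_subset_iff.2
    (clockSeq_intCast_mem_ergodicSeqs hφ)))).trans (asympClosure_ergodicSeqs_le φ)

lemma exists_mul_momSeq_sub_mem_ergodicSeqs (κ : ℝ) (t : ℕ) (hA : A ∈ positionSeqs)
    (hAu : A ∈ unitary OpSeq) : ∃ B ∈ positionSeqs, B ∈ unitary OpSeq ∧
      A * momSeq κ - B * momSeq (κ / 2 ^ t) ∈ ergodicSeqs φ := by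
  induction t generalizing A κ with
  | zero => exact ⟨A, hA, hAu, by simp⟩
  | succ t ih =>
    have hheis : heis A ∈ unitary OpSeq := Unitary.map_mem heis hAu
    obtain ⟨B, hB, hBu, hsub⟩ := ih (κ / 2)
      (mul_mem_positionSeqs (mul_mem_positionSeqs (heis_mem_positionSeqs hA)
        (clockSeq_mem_positionSeqs κ) (clockSeq_mem_unitary κ))
        (blkClockSeq_mem_positionSeqs (-(κ / 2))) (blkClockSeq_mem_unitary _))
      (mul_mem (mul_mem hheis (clockSeq_mem_unitary κ)) (blkClockSeq_mem_unitary _))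
    refine ⟨B, hB, hBu, ?_⟩
    have hevol := negligibleSeqs_le_ergodicSeqs φ
      (mul_mem_negligibleSeqs hheis (heis_momSeq_sub_mem_negligibleSeqs κ))
    have hinv := heis_sub_mem_ergodicSeqs hφ (A * momSeq κ)
    rw [map_mul] at hinv
    have h := add_mem (sub_mem hevol hinv) hsub
    rw [div_div, ← pow_succ'] at h
    convert h using 1
    simp only [mul_sub, mul_assoc]
    abel

lemma mul_momSeq_mem_ergodicSeqs (κ : ℝ) (hA : A ∈ positionSeqs) (hAu : A ∈ unitary OpSeq) :
    A * momSeq κ ∈ ergodicSeqs φ := by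
  refine asympClosure_ergodicSeqs_le φ fun ε hε => ?_
  obtain ⟨t, ht⟩ := pow_unbounded_of_one_lt (2 * Real.pi * |κ| / ε) (one_lt_two (α := ℝ))
  obtain ⟨B, hB, hBu, hsub⟩ := exists_mul_momSeq_sub_mem_ergodicSeqs hφ κ t hA hAu
  refine ⟨A * momSeq κ - B * momSeq (κ / 2 ^ t) + B,
    add_mem hsub (positionSeqs_le_ergodicSeqs hφ hB), Eventually.of_forall fun N => ?_⟩
  have hdiff : (A * momSeq κ) N - (A * momSeq κ - B * momSeq (κ / 2 ^ t) + B) N =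
      B N * (momClock N.1 (κ / 2 ^ t) - 1) := by
    simp only [Pi.add_apply, Pi.sub_apply, Pi.mul_apply, momSeq, mul_sub, mul_one]
    abel
  rw [hdiff, hsNorm_unitary_mul (mem_unitary_opSeq.1 hBu N)]
  refine (hsNorm_momClock_sub_one_le _ _).trans ?_
  rw [abs_div, abs_of_pos (by positivity : (0 : ℝ) < 2 ^ t), ← mul_div_assoc]
  exact (div_lt_comm₀ hε (by positivity)).1 ht |>.le

lemma weylTranslation_mem_ergodicSeqs (k : ℤ × ℤ) :
    (fun N => weylTranslation N.1 k : OpSeq) ∈ ergodicSeqs φ := by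
  have h := mul_momSeq_mem_ergodicSeqs hφ (-k.1) (clockSeq_mem_positionSeqs k.2)
    (clockSeq_mem_unitary k.2)
  simpa only [mem_nullFamilies, weylTranslation_eq_smul, map_smul_eq_mul, Circle.norm_coe, one_mul,
    Pi.mul_apply, clockSeq, momSeq] using h

lemma tendsto_avg_norm_expectation_weylTranslation {k : ℤ × ℤ} (hk : k ≠ 0) :
    Tendsto (fun N : EvenPos => (∑ j, ‖expectation (weylTranslation N.1 k) (φ N j)‖) / N.1)
      atTop (𝓝 0) := by
  refine (mem_nullFamilies.1 (weylTranslation_mem_ergodicSeqs hφ k)).congr' ?_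
  filter_upwards [tendsto_coe_evenPos.eventually_gt_atTop ((|k.1| + |k.2| : ℤ) : ℝ)] with N hN
  have hN' : |k.1| + |k.2| < N.1 := by exact_mod_cast hN
  rw [meanDev_apply]
  simp only [expectationDev_apply, trace_weylTranslation_eq_zero hk hN', zero_div, sub_zero]

end Ergodic

/-! ### Extraction of a set of density one -/

lemma one_sub_sqrt_avg_le_card_filter_div {β : Type*} [Fintype β] [Nonempty β] {x : β → ℝ}
    (hx : 0 ≤ x) {δ : ℝ} (hδ : δ = (∑ j, x j) / Fintype.card β) :
    1 - √δ ≤ ((Finset.univ.filter fun j => x j ≤ δ + √δ).card : ℝ) / Fintype.card β := by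
  have hcard : (0 : ℝ) < Fintype.card β := by exact_mod_cast Fintype.card_pos
  have hδ0 : 0 ≤ δ := hδ ▸ div_nonneg (Finset.sum_nonneg fun j _ => hx j) hcard.le
  have hsum : ∑ j, x j = √δ * (√δ * Fintype.card β) := by
    rw [← mul_assoc, Real.mul_self_sqrt hδ0, hδ, div_mul_cancel₀ _ hcard.ne']
  set bad := Finset.univ.filter fun j => ¬ x j ≤ δ + √δ with hbad
  have hmarkov : (bad.card : ℝ) ≤ √δ * Fintype.card β := by
    rcases (Real.sqrt_nonneg δ).eq_or_lt with h | h
    · have hzero : ∀ j, x j = 0 := fun j =>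
        (Finset.sum_eq_zero_iff_of_nonneg fun j _ => hx j).1 (hsum.trans (by rw [← h, zero_mul])) j
          (Finset.mem_univ j)
      rw [hbad, Finset.filter_false_of_mem fun j _ => not_not.2 (hzero j ▸ by positivity)]
      simpa using by positivity
    · refine le_of_mul_le_mul_left ?_ h
      calc √δ * bad.card = ∑ _j ∈ bad, √δ := by rw [Finset.sum_const, nsmul_eq_mul, mul_comm]
        _ ≤ ∑ j ∈ bad, x j := Finset.sum_le_sum fun j hj =>
            (le_add_of_nonneg_left hδ0).trans (not_le.1 (Finset.mem_filter.1 hj).2).le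
        _ ≤ ∑ j, x j := Finset.sum_le_univ_sum_of_nonneg hx
        _ = √δ * (√δ * Fintype.card β) := hsum
  rw [le_div_iff₀ hcard]
  have hsplit : ((Finset.univ.filter fun j => x j ≤ δ + √δ).card : ℝ) + bad.card =
      Fintype.card β := by
    exact_mod_cast Finset.card_filter_add_card_filter_not (s := Finset.univ) fun j => x j ≤ δ + √δ
  linarith

section Density

variable {ι : Type*} {l : Filter ι} {β : ι → Type*} [∀ i, Fintype (β i)] [∀ i, Nonempty (β i)]

lemma exists_finset_tendsto_of_tendsto_avg {x : ∀ i, β i → ℝ} (hx : ∀ i, 0 ≤ x i)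
    (h : Tendsto (fun i => (∑ j, x i j) / Fintype.card (β i)) l (𝓝 0)) :
    ∃ J : ∀ i, Finset (β i), (∀ i, (J i).Nonempty) ∧
      Tendsto (fun i => ((J i).card : ℝ) / Fintype.card (β i)) l (𝓝 1) ∧
      ∀ j : ∀ i, β i, (∀ i, j i ∈ J i) → Tendsto (fun i => x i (j i)) l (𝓝 0) := by
  set δ : ι → ℝ := fun i => (∑ j, x i j) / Fintype.card (β i) with hδ
  have hcard : ∀ i, (0 : ℝ) < Fintype.card (β i) := fun i => by exact_mod_cast Fintype.card_pos
  have hsqrt : Tendsto (fun i => √(δ i)) l (𝓝 0) := by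
    simpa only [Real.sqrt_zero] using h.sqrt
  refine ⟨fun i => Finset.univ.filter fun j => x i j ≤ δ i + √(δ i), fun i => ?_, ?_, ?_⟩
  · obtain ⟨j, -, hj⟩ := Finset.exists_le_of_sum_le (s := Finset.univ) (f := x i)
      (g := fun _ => δ i) Finset.univ_nonempty
      (by rw [Finset.sum_const, nsmul_eq_mul, Finset.card_univ, hδ,
        mul_div_cancel₀ _ (hcard i).ne'])
    exact ⟨j, Finset.mem_filter.2
      ⟨Finset.mem_univ j, hj.trans (le_add_of_nonneg_right (Real.sqrt_nonneg _))⟩⟩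
  · refine tendsto_of_tendsto_of_tendsto_of_le_of_le (by simpa using hsqrt.const_sub 1)
      tendsto_const_nhds (fun i => one_sub_sqrt_avg_le_card_filter_div (hx i) rfl) fun i => ?_
    exact div_le_one_of_le₀ (Nat.cast_le.2 (Finset.card_le_univ _)) (hcard i).le
  · intro j hj
    exact squeeze_zero (fun i => hx i (j i)) (fun i => (Finset.mem_filter.1 (hj i)).2)
      (by simpa using h.add hsqrt)

/-- The averages of countably many quantities are controlled at once by a weighted sum. -/
lemma exists_finset_forall_tendsto_of_tendsto_avg {κ : Type*} [Countable κ]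
    {x : κ → ∀ i, β i → ℝ} (hx₀ : ∀ k i, 0 ≤ x k i) (hx₁ : ∀ k i, x k i ≤ 1)
    (h : ∀ k, Tendsto (fun i => (∑ j, x k i j) / Fintype.card (β i)) l (𝓝 0)) :
    ∃ J : ∀ i, Finset (β i), (∀ i, (J i).Nonempty) ∧
      Tendsto (fun i => ((J i).card : ℝ) / Fintype.card (β i)) l (𝓝 1) ∧
      ∀ j : ∀ i, β i, (∀ i, j i ∈ J i) → ∀ k, Tendsto (fun i => x k i (j i)) l (𝓝 0) := by
  have := Encodable.ofCountable κ
  obtain ⟨w, hw, c, hc, -⟩ := posSumOfEncodable one_pos κ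
  have hterm₀ : ∀ i j k, 0 ≤ w k * x k i j := fun i j k => mul_nonneg (hw k).le (hx₀ k i j)
  have hterm : ∀ i j, Summable fun k => w k * x k i j := fun i j =>
    hc.summable.of_nonneg_of_le (hterm₀ i j) fun k =>
      mul_le_of_le_one_right (hw k).le (hx₁ k i j)
  have havg : ∀ i, (∑ j, ∑' k, w k * x k i j) / Fintype.card (β i) =
      ∑' k, w k * ((∑ j, x k i j) / Fintype.card (β i)) := fun i => by
    rw [← Summable.tsum_finsetSum fun j _ => hterm i j, ← tsum_div_const]
    simp only [← Finset.mul_sum, mul_div_assoc]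
  have hlim : Tendsto (fun i => (∑ j, ∑' k, w k * x k i j) / Fintype.card (β i)) l (𝓝 0) := by
    simp only [havg]
    rw [← tsum_zero (α := ℝ) (β := κ)]
    refine tendsto_tsum_of_dominated_convergence hc.summable
      (fun k => by simpa using (h k).const_mul (w k)) (Eventually.of_forall fun i k => ?_)
    have hnonneg : 0 ≤ (∑ j, x k i j) / Fintype.card (β i) :=
      div_nonneg (Finset.sum_nonneg fun j _ => hx₀ k i j) (Nat.cast_nonneg _)
    rw [Real.norm_of_nonneg (mul_nonneg (hw k).le hnonneg)]
    refine mul_le_of_le_one_right (hw k).le (div_le_one_of_le₀ ?_ (Nat.cast_nonneg _))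
    exact (Finset.sum_le_sum fun j _ => hx₁ k i j).trans (by simp)
  obtain ⟨J, hne, hcard, hJ⟩ := exists_finset_tendsto_of_tendsto_avg
    (fun i j => tsum_nonneg (hterm₀ i j)) hlim
  refine ⟨J, hne, hcard, fun j hj k => squeeze_zero (fun i => hx₀ k i (j i)) (fun i => ?_)
    (by simpa using (hJ j hj).const_mul (w k)⁻¹)⟩
  rw [le_inv_mul_iff₀ (hw k)]
  exact (hterm i (j i)).le_tsum k fun k' _ => hterm₀ i (j i) k'

end Density

/-! ### Absolute summability of Fourier coefficients -/

lemma conj_fourierMode (k : ℤ × ℤ) (x : ℝ × ℝ) :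
    (starRingEnd ℂ) (fourierMode k x) = fourierMode (-k) x := by
  rw [fourierMode, fourierMode, ← Complex.exp_conj]
  simp only [map_mul, map_sub, map_ofNat, map_intCast, Complex.conj_ofReal, Complex.conj_I,
    Prod.fst_neg, Prod.snd_neg, Int.cast_neg]
  ring_nf

lemma norm_fourierMode (k : ℤ × ℤ) (x : ℝ × ℝ) : ‖fourierMode k x‖ = 1 := by
  have h : 2 * Real.pi * Complex.I * (x.1 * k.2 - x.2 * k.1) =
      ((2 * Real.pi * (x.1 * k.2 - x.2 * k.1) : ℝ) : ℂ) * Complex.I := by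
    push_cast
    ring
  rw [fourierMode, h, Complex.norm_exp_ofReal_mul_I]

lemma contDiff_fourierMode (k : ℤ × ℤ) : ContDiff ℝ ∞ (fourierMode k) := by
  have hofReal : ContDiff ℝ ∞ ((↑) : ℝ → ℂ) := Complex.ofRealCLM.contDiff
  unfold fourierMode
  fun_prop

lemma fderiv_fourierMode (k : ℤ × ℤ) (x v : ℝ × ℝ) :
    fderiv ℝ (fourierMode k) x v =
      2 * Real.pi * Complex.I * (v.1 * k.2 - v.2 * k.1) * fourierMode k x := by
  let phase : ℝ × ℝ →L[ℝ] ℂ := (2 * Real.pi * Complex.I : ℂ) •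
    ((k.2 : ℂ) • Complex.ofRealCLM.comp (ContinuousLinearMap.fst ℝ ℝ ℝ) -
      (k.1 : ℂ) • Complex.ofRealCLM.comp (ContinuousLinearMap.snd ℝ ℝ ℝ))
  have hphase : ∀ v, phase v = 2 * Real.pi * Complex.I * (v.1 * k.2 - v.2 * k.1) := fun v => by
    simp [phase]
    ring
  have h : HasFDerivAt (fourierMode k) (Complex.exp (phase x) • phase) x := by
    rw [show fourierMode k = fun y => Complex.exp (phase y) from
      funext fun y => congrArg Complex.exp (hphase y).symm]
    exact phase.hasFDerivAt.cexp
  rw [h.fderiv, smul_apply, smul_eq_mul, mul_comm, hphase, hphase, fourierMode]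

lemma isSmoothOnTorus_fourierMode (k : ℤ × ℤ) : IsSmoothOnTorus (fourierMode k) where
  contDiff := contDiff_fourierMode k
  periodic q p m n := by
    rw [fourierMode, fourierMode, Complex.exp_eq_exp_iff_exists_int]
    refine ⟨m * k.2 - n * k.1, ?_⟩
    push_cast
    ring

lemma torusIntegral_eq_setIntegral_Icc (f : ℝ × ℝ → ℂ) :
    torusIntegral f = ∫ x in Set.Icc (0 : ℝ × ℝ) 1, f x := by
  refine setIntegral_congr_set ?_
  rw [← Prod.mk_zero_zero, ← Prod.mk_one_one, ← Set.Icc_prod_Icc]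
  exact Measure.set_prod_ae_eq Ico_ae_eq_Icc Ico_ae_eq_Icc

lemma norm_torusIntegral_le {f : ℝ × ℝ → ℂ} {C : ℝ} (hC : ∀ x ∈ Set.Icc (0 : ℝ × ℝ) 1, ‖f x‖ ≤ C) :
    ‖torusIntegral f‖ ≤ C := by
  have hvol : volume (Set.Icc (0 : ℝ × ℝ) 1) = 1 := by
    rw [← Prod.mk_zero_zero, ← Prod.mk_one_one, ← Set.Icc_prod_Icc, Measure.volume_eq_prod,
      Measure.prod_prod]
    simp
  rw [torusIntegral_eq_setIntegral_Icc]
  simpa [Measure.real, hvol] using norm_setIntegral_le_of_norm_le_const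
    (hvol.trans_lt ENNReal.one_lt_top) hC

lemma torusIntegral_fderiv_eq_zero {f : ℝ × ℝ → ℂ} (hf : ContDiff ℝ 1 f)
    (hfst : ∀ p, f (1, p) = f (0, p)) (hsnd : ∀ q, f (q, 1) = f (q, 0)) (v : ℝ × ℝ) :
    torusIntegral (fun x => fderiv ℝ f x v) = 0 := by
  have hderiv : ∀ (c : ℝ) (x : ℝ × ℝ), HasFDerivAt (fun x => c • f x) (c • fderiv ℝ f x) x :=
    fun c x => (hf.differentiable one_ne_zero x).hasFDerivAt.const_smul c
  have hsplit : ∀ x, fderiv ℝ f x v =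
      (v.1 • fderiv ℝ f x) (1, 0) + (v.2 • fderiv ℝ f x) (0, 1) := fun x => by
    rw [smul_apply, smul_apply, ← map_smul, ← map_smul, ← map_add]
    simp
  have hcont : Continuous fun x => fderiv ℝ f x v :=
    (hf.continuous_fderiv one_ne_zero).clm_apply continuous_const
  have hcont_smul : ∀ c : ℝ, ContinuousOn (fun x => c • f x) (Set.Icc 0 1) := fun c =>
    (hf.continuous.const_smul c).continuousOn
  have hint := hcont.integrableOn_Icc (μ := volume) (a := (0 : ℝ × ℝ)) (b := 1)
  rw [torusIntegral_eq_setIntegral_Icc]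
  simp only [hsplit] at hint ⊢
  rw [integral_divergence_prod_Icc_of_hasFDerivAt_of_le (fun x => v.1 • f x) (fun x => v.2 • f x)
    _ _ 0 1 zero_le_one (hcont_smul v.1) (hcont_smul v.2) (fun x _ => hderiv v.1 x)
    (fun x _ => hderiv v.2 x) hint]
  simp [hfst, hsnd]

namespace IsSmoothOnTorus

variable {a b : ℝ × ℝ → ℂ}

lemma integrableOn (ha : IsSmoothOnTorus a) :
    IntegrableOn a (Set.Ico (0 : ℝ) 1 ×ˢ Set.Ico (0 : ℝ) 1) :=
  (ha.contDiff.continuous.continuousOn.integrableOn_compact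
    (isCompact_Icc.prod isCompact_Icc)).mono_set
    (Set.prod_mono Set.Ico_subset_Icc_self Set.Ico_subset_Icc_self)

lemma mul (ha : IsSmoothOnTorus a) (hb : IsSmoothOnTorus b) :
    IsSmoothOnTorus fun x => a x * b x where
  contDiff := ha.contDiff.mul hb.contDiff
  periodic q p m n := by rw [ha.periodic, hb.periodic]

lemma sub (ha : IsSmoothOnTorus a) (hb : IsSmoothOnTorus b) :
    IsSmoothOnTorus fun x => a x - b x where
  contDiff := ha.contDiff.sub hb.contDiff
  periodic q p m n := by rw [ha.periodic, hb.periodic]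

lemma const_mul (c : ℂ) (ha : IsSmoothOnTorus a) : IsSmoothOnTorus fun x => c * a x where
  contDiff := contDiff_const.mul ha.contDiff
  periodic q p m n := by rw [ha.periodic]

lemma fderiv_apply (ha : IsSmoothOnTorus a) (v : ℝ × ℝ) :
    IsSmoothOnTorus fun x => fderiv ℝ a x v where
  contDiff := (ha.contDiff.fderiv_right (m := ∞) le_rfl).clm_apply contDiff_const
  periodic q p m n := by
    have hper : (fun x : ℝ × ℝ => a (x + ((m : ℝ), (n : ℝ)))) = a :=
      funext fun x => ha.periodic x.1 x.2 m n
    have h := fderiv_comp_add_right (𝕜 := ℝ) (f := a) (x := (q, p)) ((m : ℝ), (n : ℝ))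
    rw [hper] at h
    exact congrArg (· v) h.symm

lemma torusIntegral_fderiv (ha : IsSmoothOnTorus a) (v : ℝ × ℝ) :
    torusIntegral (fun x => fderiv ℝ a x v) = 0 :=
  torusIntegral_fderiv_eq_zero (ha.contDiff.of_le (by simp))
    (fun p => by simpa using ha.periodic 0 p 1 0) (fun q => by simpa using ha.periodic q 0 0 1) v

lemma conj_fourierMode_mul (ha : IsSmoothOnTorus a) (k : ℤ × ℤ) :
    IsSmoothOnTorus fun x => (starRingEnd ℂ) (fourierMode k x) * a x := by
  simpa only [conj_fourierMode] using (isSmoothOnTorus_fourierMode (-k)).mul ha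

lemma torusFourierCoeff_sub (ha : IsSmoothOnTorus a) (hb : IsSmoothOnTorus b) (k : ℤ × ℤ) :
    torusFourierCoeff (fun x => a x - b x) k = torusFourierCoeff a k - torusFourierCoeff b k := by
  simp only [torusFourierCoeff, mul_sub]
  exact integral_sub (ha.conj_fourierMode_mul k).integrableOn
    (hb.conj_fourierMode_mul k).integrableOn

lemma torusFourierCoeff_fderiv (ha : IsSmoothOnTorus a) (v : ℝ × ℝ) (k : ℤ × ℤ) :
    torusFourierCoeff (fun x => fderiv ℝ a x v) k =
      2 * Real.pi * Complex.I * (v.1 * k.2 - v.2 * k.1) * torusFourierCoeff a k := by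
  set c : ℂ := 2 * Real.pi * Complex.I * (v.1 * k.2 - v.2 * k.1) with hc
  have hprod : ∀ x, fderiv ℝ (fun x => (starRingEnd ℂ) (fourierMode k x) * a x) x v =
      (starRingEnd ℂ) (fourierMode k x) * fderiv ℝ a x v -
        c * ((starRingEnd ℂ) (fourierMode k x) * a x) := fun x => by
    simp only [conj_fourierMode]
    rw [fderiv_fun_mul ((contDiff_fourierMode _).differentiable (by simp) x)
      (ha.contDiff.differentiable (by simp) x)]
    simp only [add_apply, smul_apply, smul_eq_mul, fderiv_fourierMode, hc, Prod.fst_neg,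
      Prod.snd_neg]
    push_cast
    ring
  have hzero := (ha.conj_fourierMode_mul k).torusIntegral_fderiv v
  simp only [hprod] at hzero
  rw [torusIntegral, integral_sub ((ha.fderiv_apply v).conj_fourierMode_mul k).integrableOn
    ((ha.conj_fourierMode_mul k).const_mul c).integrableOn, integral_const_mul] at hzero
  exact sub_eq_zero.1 hzero

lemma exists_torusFourierCoeff_eq (ha : IsSmoothOnTorus a) (v : ℝ × ℝ) :
    ∃ b, IsSmoothOnTorus b ∧ ∀ k, torusFourierCoeff b k =
      ((1 + (v.1 * k.2 - v.2 * k.1) ^ 2 : ℝ) : ℂ) * torusFourierCoeff a k := by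
  have hda := ha.fderiv_apply v
  have hcda := hda.const_mul ((2 * Real.pi : ℂ) ^ 2)⁻¹
  refine ⟨_, ha.sub (hcda.fderiv_apply v), fun k => ?_⟩
  have hpi : (Real.pi : ℂ) ≠ 0 := Complex.ofReal_ne_zero.2 Real.pi_ne_zero
  have hconst : torusFourierCoeff (fun x => ((2 * Real.pi : ℂ) ^ 2)⁻¹ * fderiv ℝ a x v) k =
      ((2 * Real.pi : ℂ) ^ 2)⁻¹ * torusFourierCoeff (fun x => fderiv ℝ a x v) k := by
    simp only [torusFourierCoeff, mul_left_comm]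
    exact integral_const_mul _ _
  rw [torusFourierCoeff_sub ha (hcda.fderiv_apply v), hcda.torusFourierCoeff_fderiv, hconst,
    ha.torusFourierCoeff_fderiv]
  push_cast
  field_simp
  linear_combination (-torusFourierCoeff a k * (v.1 * k.2 - v.2 * k.1) ^ 2) * Complex.I_sq

lemma exists_norm_torusFourierCoeff_le (ha : IsSmoothOnTorus a) :
    ∃ C, ∀ k, ‖torusFourierCoeff a k‖ ≤ C := by
  obtain ⟨C, hC⟩ := isCompact_Icc.exists_bound_of_continuousOn
    (s := Set.Icc (0 : ℝ × ℝ) 1) ha.contDiff.continuous.continuousOn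
  refine ⟨C, fun k => norm_torusIntegral_le fun x hx => ?_⟩
  rw [norm_mul, Complex.norm_conj, norm_fourierMode, one_mul]
  exact hC x hx

end IsSmoothOnTorus

lemma summable_inv_one_add_intCast_sq : Summable fun m : ℤ => (1 + (m : ℝ) ^ 2)⁻¹ := by
  refine Summable.of_norm_bounded_eventually
    (Real.summable_one_div_int_pow.2 (le_refl 2)) ?_
  filter_upwards [(Set.finite_singleton (0 : ℤ)).compl_mem_cofinite] with m hm
  have hm' : (m : ℝ) ≠ 0 := Int.cast_ne_zero.2 hm
  rw [Real.norm_of_nonneg (by positivity), one_div]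
  gcongr
  exact le_add_of_nonneg_left zero_le_one

lemma IsSmoothOnTorus.summable_norm_torusFourierCoeff {a : ℝ × ℝ → ℂ} (ha : IsSmoothOnTorus a) :
    Summable fun k => ‖torusFourierCoeff a k‖ := by
  obtain ⟨b, hb, hab⟩ := ha.exists_torusFourierCoeff_eq (1, 0)
  obtain ⟨c, hc, hbc⟩ := hb.exists_torusFourierCoeff_eq (0, 1)
  obtain ⟨C, hC⟩ := hc.exists_norm_torusFourierCoeff_le
  refine Summable.of_nonneg_of_le (fun k => norm_nonneg _) (fun k => ?_)
    ((summable_inv_one_add_intCast_sq.mul_of_nonneg summable_inv_one_add_intCast_sq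
      (fun m => by positivity) fun m => by positivity).mul_left C)
  have h := hC k
  rw [hbc, hab, norm_mul, norm_mul, Complex.norm_of_nonneg (by positivity),
    Complex.norm_of_nonneg (by positivity)] at h
  rw [← mul_inv, ← div_eq_mul_inv, le_div_iff₀ (by positivity)]
  refine le_trans (le_of_eq ?_) h
  ring

/-! ### Quantum ergodicity of the baker's map -/

lemma weylTranslation_zero (M : ℕ) : weylTranslation M 0 = 1 := by
  simp [weylTranslation_eq_smul, momClock_zero]

lemma torusFourierCoeff_zero (a : ℝ × ℝ → ℂ) : torusFourierCoeff a 0 = torusIntegral a := by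
  simp [torusFourierCoeff, fourierMode]

lemma expectation_weylOp {a : ℝ × ℝ → ℂ} (ha : Summable fun k => ‖torusFourierCoeff a k‖) {M : ℕ}
    (ψ : QState M) : expectation (weylOp M a) ψ =
      ∑' k, torusFourierCoeff a k * expectation (weylTranslation M k) ψ := by
  have hsum : Summable fun k => torusFourierCoeff a k • weylTranslation M k := by
    refine Pi.summable.2 fun i => Pi.summable.2 fun j => Summable.of_norm_bounded ha fun k => ?_
    rw [Matrix.smul_apply, norm_smul]
    exact mul_le_of_le_one_right (norm_nonneg _)
      (entry_norm_bound_of_unitary (weylTranslation_mem_unitaryGroup M k) i j)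
  have h := hsum.map_tsum (expectationForm ψ) (expectationForm ψ).continuous_of_finiteDimensional
  simpa only [map_smul, smul_eq_mul, expectationForm_apply, weylOp] using h

lemma tendsto_expectation_weylOp {ψ : ∀ N : EvenPos, QState N.1} (hψ : ∀ N, ‖ψ N‖ = 1)
    (h : ∀ k ≠ 0, Tendsto (fun N => expectation (weylTranslation N.1 k) (ψ N)) atTop (𝓝 0))
    {a : ℝ × ℝ → ℂ} (ha : Summable fun k => ‖torusFourierCoeff a k‖) :
    Tendsto (fun N => expectation (weylOp N.1 a) (ψ N)) atTop (𝓝 (torusIntegral a)) := by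
  simp only [expectation_weylOp ha]
  rw [← tsum_ite_eq (0 : ℤ × ℤ) fun _ => torusIntegral a]
  refine tendsto_tsum_of_dominated_convergence ha (fun k => ?_)
    (Eventually.of_forall fun N k => ?_)
  · split_ifs with hk
    · subst hk
      simp only [weylTranslation_zero, torusFourierCoeff_zero, expectation_one (hψ _), mul_one,
        tendsto_const_nhds]
    · simpa using (h k hk).const_mul (torusFourierCoeff a k)
  · rw [norm_mul]
    exact mul_le_of_le_one_right (norm_nonneg _)
      (norm_expectation_le_one (weylTranslation_mem_unitaryGroup N.1 k) (hψ N))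

lemma exists_finset_forall_tendsto_expectation_weylTranslation
    {φ : ∀ N : EvenPos, OrthonormalBasis (Fin N.1) ℂ (QState N.1)}
    (hφ : ∀ (N : EvenPos) (j : Fin N.1), ∃ μ : ℂ,
      Matrix.toEuclideanLin (bakerOp N) (φ N j) = μ • φ N j) :
    ∃ J : ∀ N : EvenPos, Finset (Fin N.1), (∀ N, (J N).Nonempty) ∧
      Tendsto (fun N : EvenPos => ((J N).card : ℝ) / N.1) atTop (𝓝 1) ∧
      ∀ j : ∀ N : EvenPos, Fin N.1, (∀ N, j N ∈ J N) → ∀ k ≠ 0,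
        Tendsto (fun N => expectation (weylTranslation N.1 k) (φ N (j N))) atTop (𝓝 0) := by
  have hne : ∀ N : EvenPos, Nonempty (Fin N.1) := fun N => ⟨⟨0, N.2.1⟩⟩
  have h := exists_finset_forall_tendsto_of_tendsto_avg (l := atTop) (κ := {k : ℤ × ℤ // k ≠ 0})
    (x := fun k (N : EvenPos) j => ‖expectation (weylTranslation N.1 k) (φ N j)‖)
    (fun k N j => norm_nonneg _)
    (fun k N j => norm_expectation_le_one (weylTranslation_mem_unitaryGroup _ _)
      ((φ N).norm_eq_one j))
    (fun k => by
      simpa only [Fintype.card_fin] using tendsto_avg_norm_expectation_weylTranslation hφ k.2)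
  simp only [Fintype.card_fin] at h
  obtain ⟨J, hJne, hcard, hJ⟩ := h
  exact ⟨J, hJne, hcard, fun j hj k hk => tendsto_zero_iff_norm_tendsto_zero.2 (hJ j hj ⟨k, hk⟩)⟩

end QuantumBaker

end

theorem corollary1_general
    (φ : ∀ N : QuantumBaker.EvenPos,
      OrthonormalBasis (Fin N.1) ℂ (QuantumBaker.QState N.1))
    (hφ : ∀ (N : QuantumBaker.EvenPos) (j : Fin N.1), ∃ μ : ℂ,
      Matrix.toEuclideanLin (QuantumBaker.bakerOp N) (φ N j) = μ • φ N j) :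
    ∃ J : ∀ N : QuantumBaker.EvenPos, Finset (Fin N.1),
      (∀ N : QuantumBaker.EvenPos, (J N).Nonempty) ∧
      Tendsto (fun N : QuantumBaker.EvenPos => ((J N).card : ℝ) / (N.1 : ℝ)) atTop (𝓝 1) ∧
      ∀ a : ℝ × ℝ → ℂ, IntegrableOn a (Set.Ico (0 : ℝ) 1 ×ˢ Set.Ico (0 : ℝ) 1) →
        (Summable fun k => ‖QuantumBaker.torusFourierCoeff a k‖) →
        ∀ j : (∀ N : QuantumBaker.EvenPos, Fin N.1), (∀ N, j N ∈ J N) →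
          Tendsto
            (fun N : QuantumBaker.EvenPos =>
              QuantumBaker.expectation (QuantumBaker.weylOp N.1 a) (φ N (j N)))
            atTop (𝓝 (QuantumBaker.torusIntegral a)) := by
  obtain ⟨J, hne, hcard, hJ⟩ :=
    QuantumBaker.exists_finset_forall_tendsto_expectation_weylTranslation hφ
  exact ⟨J, hne, hcard, fun a _ ha j hj => QuantumBaker.tendsto_expectation_weylOp
    (fun N => (φ N).norm_eq_one (j N)) (hJ j hj) ha⟩

theorem corollary1
    (φ : ∀ N : QuantumBaker.EvenPos,
      OrthonormalBasis (Fin N.1) ℂ (QuantumBaker.QState N.1))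
    (hφ : ∀ (N : QuantumBaker.EvenPos) (j : Fin N.1), ∃ μ : ℂ,
      Matrix.toEuclideanLin (QuantumBaker.bakerOp N) (φ N j) = μ • φ N j) :
    ∃ J : ∀ N : QuantumBaker.EvenPos, Finset (Fin N.1),
      (∀ N : QuantumBaker.EvenPos, (J N).Nonempty) ∧
      Tendsto (fun N : QuantumBaker.EvenPos => ((J N).card : ℝ) / (N.1 : ℝ)) atTop (𝓝 1) ∧
      ∀ a : ℝ × ℝ → ℂ, QuantumBaker.IsSmoothOnTorus a →
        ∀ j : (∀ N : QuantumBaker.EvenPos, Fin N.1), (∀ N, j N ∈ J N) →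
          Tendsto
            (fun N : QuantumBaker.EvenPos =>
              QuantumBaker.expectation (QuantumBaker.weylOp N.1 a) (φ N (j N)))
            atTop (𝓝 (QuantumBaker.torusIntegral a)) := by
  obtain ⟨J, hne, hcard, hJ⟩ := corollary1_general φ hφ
  exact ⟨J, hne, hcard, fun a ha => hJ a ha.integrableOn ha.summable_norm_torusFourierCoeff⟩
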